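/- Let $n\ge 0$. Let $\mathbf{Y}^{\mathrm{rtt}}(\mathfrak{gl}_n)^{\mathrm{pol}}$ be the associative $\mathbb{C}$-algebra generated by $t_{ij}^{(r)}$ ($1\le i,j\le n$, $r\in\mathbb{Z}$) with relations $$[t_{ij}^{(p+1)},t_{kl}^{(q)}]-[t_{ij}^{(p)},t_{kl}^{(q+1)}]=t_{kj}^{(q)}t_{il}^{(p)}-t_{kj}^{(p)}t_{il}^{(q)},\qquad p,q\in\mathbb{Z},$$ and for an integer $N\ge 0$ let $\mathbf{Y}_N=\mathbf{Y}^{\mathrm{rtt}}(\mathfrak{gl}_n)_N$ be its quotient by the two-sided ideal generated by the $t_{ij}^{(-r)}$ with $r>N$. Filter $\mathbf{Y}_N$ by letting $F_d$ be the span of all products $t_{i_1j_1}^{(r_1)}\cdots t_{i_mj_m}^{(r_m)}$ with $r_1+\dots+r_m\le d$ ($d\in\mathbb{Z}$). Then $[F_d,F_e]\subseteq F_{d+e-1}$, so $\operatorname{gr}\mathbf{Y}_N=\bigoplus_d F_d/F_{d-1}$ is commutative and carries the bracket $\{\bar x,\bar y\}=\overline{xy-yx}\in F_{d+e-1}/F_{d+e-2}$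 for $x\in F_d$, $y\in F_e$. Let $\operatorname{gr}t_{ij}^{(r)}$ be the class of $t_{ij}^{(r)}$ in $F_r/F_{r-1}$, and put $\operatorname{gr}\mathbf{Y}^{\mathrm{rtt}}(\mathfrak{gl}_n)=\varprojlim_N\operatorname{gr}\mathbf{Y}_N$ with the induced bracket. Let $\mathcal{O}(z^N\mathrm{Mat}_n[[z^{-1}]])=\mathbb{C}[\Delta_{ij}^{(r)}: 1\le i,j\le n,\ r\ge -N]$, where $\Delta_{ij}^{(r)}$ is the coefficient of $z^{-r}$ in the $(i,j)$ entry (and $\Delta_{ij}^{(r)}=0$ for $r<-N$), with the bracket that is a derivation in each argument and is determined by $$\{\Delta_{ij}^{(p+1)},\Delta_{kl}^{(q)}\}-\{\Delta_{ij}^{(p)},\Delta_{kl}^{(q+1)}\}=\Delta_{il}^{(p)}\Delta_{kj}^{(q)}-\Delta_{kj}^{(p)}\Delta_{il}^{(q)},\qquad p,q\in\mathbb{Z},$$ and let $\mathcal{O}(\mathrm{Mat}_n((z^{-1})))=\varprojlim_N\mathcal{O}(z^N\mathrm{Mat}_n[[z^{-1}]])$ with the induced bracket. Then: 1. For every $N\ge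 0$ and every total order on the set of indices $(i,j,r)$ with $1\le i,j\le n$, $r\ge -N$, the ordered monomials in the $t_{ij}^{(r)}$, $r\ge -N$, form a $\mathbb{C}$-basis of $\mathbf{Y}_N$. 2. For every $N\ge 0$, $\operatorname{gr}\mathbf{Y}_N$ is the polynomial algebra over $\mathbb{C}$ in the generators $\operatorname{gr}t_{ij}^{(r)}$, $1\le i,j\le n$, $r\ge -N$. 3. The brackets on $\operatorname{gr}\mathbf{Y}_N$, $\mathcal{O}(z^N\mathrm{Mat}_n[[z^{-1}]])$ ($N\ge 0$), $\operatorname{gr}\mathbf{Y}^{\mathrm{rtt}}(\mathfrak{gl}_n)$ and $\mathcal{O}(\mathrm{Mat}_n((z^{-1})))$ are Poisson brackets, and there is an isomorphism of Poisson algebras $$\operatorname{gr}\mathbf{Y}^{\mathrm{rtt}}(\mathfrak{gl}_n)\ \xrightarrow{\ \sim\ }\ \mathcal{O}(\mathrm{Mat}_n((z^{-1}))),\qquad \operatorname{gr}t_{ij}^{(r)}\mapsto\Delta_{ij}^{(r)}\quad(1\le i,j\le n,\ r\in\mathbb{Z}),$$ which is the inverse limit of isomorphisms of Poisson algebras $\operatorname{gr}\mathbf{Y}_N\xrightarrow{\sim}\mathcal{O}(z^N\mathrm{Mat}_n[[z^{-1}]])$,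 $\operatorname{gr}t_{ij}^{(r)}\mapsto\Delta_{ij}^{(r)}$. -/

import Mathlib

open scoped DirectSum

/-! ### Associated graded algebras of filtered quantizations -/

/-- An increasing `ℤ`-filtration `⋯ ⊆ F d ⊆ F (d + 1) ⊆ ⋯` of a `ℂ`-algebra such that
`1 ∈ F 0`, `F d * F e ⊆ F (d + e)` and `[F d, F e] ⊆ F (d + e - 1)`. -/
structure QFiltration (A : Type) [Ring A] [Algebra ℂ A] where
  F : ℤ → Submodule ℂ A
  mono : Monotone F
  one_mem : (1 : A) ∈ F 0
  mul_mem : ∀ {d e : ℤ} {x y : A}, x ∈ F d → y ∈ F e → x * y ∈ F (d + e)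
  comm_mem : ∀ {d e : ℤ} {x y : A}, x ∈ F d → y ∈ F e → x * y - y * x ∈ F (d + e - 1)

namespace QFiltration

section

variable {A : Type} [Ring A] [Algebra ℂ A] (Q : QFiltration A)

/-- The homogeneous component `F d / F (d - 1)` of the associated graded algebra. -/
def Piece (d : ℤ) : Type := ↥(Q.F d) ⧸ (Q.F (d - 1)).submoduleOf (Q.F d)

instance (d : ℤ) : AddCommGroup (Q.Piece d) :=
  inferInstanceAs (AddCommGroup (↥(Q.F d) ⧸ (Q.F (d - 1)).submoduleOf (Q.F d)))

instance (d : ℤ) : Module ℂ (Q.Piece d) :=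
  inferInstanceAs (Module ℂ (↥(Q.F d) ⧸ (Q.F (d - 1)).submoduleOf (Q.F d)))

/-- The class in `F d / F (d - 1)` of an element of `F d`. -/
def cls (d : ℤ) : ↥(Q.F d) →ₗ[ℂ] Q.Piece d := ((Q.F (d - 1)).submoduleOf (Q.F d)).mkQ

theorem cls_surjective (d : ℤ) : Function.Surjective (Q.cls d) :=
  Submodule.mkQ_surjective _

theorem cls_eq_zero {d : ℤ} {x : A} (hx : x ∈ Q.F d) (h : x ∈ Q.F (d - 1)) :
    Q.cls d ⟨x, hx⟩ = 0 :=
  (Submodule.Quotient.mk_eq_zero _).2 h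

theorem cls_congr {d : ℤ} {x y : A} (hx : x ∈ Q.F d) (hy : y ∈ Q.F d)
    (h : x - y ∈ Q.F (d - 1)) : Q.cls d ⟨x, hx⟩ = Q.cls d ⟨y, hy⟩ :=
  (Submodule.Quotient.eq _).2 h

theorem mk_cls_congr {d e : ℤ} (hde : d = e) {x y : A} (hx : x ∈ Q.F d) (hy : y ∈ Q.F e)
    (h : x = y) : GradedMonoid.mk (A := Q.Piece) d (Q.cls d ⟨x, hx⟩)
      = GradedMonoid.mk e (Q.cls e ⟨y, hy⟩) := by
  subst hde; subst h; rfl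

/-- Multiplication `F d × F e → F (d + e) / F (d + e - 1)`. -/
def mulAux (d e : ℤ) : ↥(Q.F d) →ₗ[ℂ] ↥(Q.F e) →ₗ[ℂ] Q.Piece (d + e) :=
  LinearMap.mk₂ ℂ (fun x y => Q.cls (d + e) ⟨x.1 * y.1, Q.mul_mem x.2 y.2⟩)
    (fun x x' y => by
      rw [← map_add]; congr 1; ext; simp [add_mul])
    (fun c x y => by
      rw [← map_smul]; congr 1; ext; simp)
    (fun x y y' => by
      rw [← map_add]; congr 1; ext; simp [mul_add])
    (fun c x y => by
      rw [← map_smul]; congr 1; ext; simp)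

/-- Multiplication `F d / F (d - 1) × F e / F (e - 1) → F (d + e) / F (d + e - 1)`. -/
def pieceMul (d e : ℤ) : Q.Piece d →ₗ[ℂ] Q.Piece e →ₗ[ℂ] Q.Piece (d + e) :=
  Submodule.liftQ _
    (LinearMap.flip (Submodule.liftQ _ (LinearMap.flip (Q.mulAux d e)) (by
      intro y hy
      rw [LinearMap.mem_ker]
      ext x
      refine Q.cls_eq_zero _ ?_
      have h := Q.mul_mem x.2 (Submodule.mem_comap.1 hy)
      rwa [← add_sub_assoc] at h)))
    (by
      intro x hx
      rw [LinearMap.mem_ker]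
      refine LinearMap.ext fun y => ?_
      obtain ⟨y, rfl⟩ := Q.cls_surjective e y
      refine Q.cls_eq_zero _ ?_
      have h := Q.mul_mem (Submodule.mem_comap.1 hx) y.2
      rwa [sub_add_eq_add_sub] at h)

theorem pieceMul_cls {d e : ℤ} (x : ↥(Q.F d)) (y : ↥(Q.F e)) :
    Q.pieceMul d e (Q.cls d x) (Q.cls e y)
      = Q.cls (d + e) ⟨x.1 * y.1, Q.mul_mem x.2 y.2⟩ := rfl

/-- The commutator `F d × F e → F (d + e - 1) / F (d + e - 2)`. -/
def brAux (d e : ℤ) : ↥(Q.F d) →ₗ[ℂ] ↥(Q.F e) →ₗ[ℂ] Q.Piece (d + e - 1) :=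
  LinearMap.mk₂ ℂ (fun x y => Q.cls (d + e - 1) ⟨x.1 * y.1 - y.1 * x.1, Q.comm_mem x.2 y.2⟩)
    (fun x x' y => by
      rw [← map_add]; congr 1; ext; simp [add_mul, mul_add]; abel)
    (fun c x y => by
      rw [← map_smul]; congr 1; ext; simp [smul_sub])
    (fun x y y' => by
      rw [← map_add]; congr 1; ext; simp [add_mul, mul_add]; abel)
    (fun c x y => by
      rw [← map_smul]; congr 1; ext; simp [smul_sub])

/-- The commutator induces
`F d / F (d - 1) × F e / F (e - 1) → F (d + e - 1) / F (d + e - 2)`. -/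
def pieceBr (d e : ℤ) : Q.Piece d →ₗ[ℂ] Q.Piece e →ₗ[ℂ] Q.Piece (d + e - 1) :=
  Submodule.liftQ _
    (LinearMap.flip (Submodule.liftQ _ (LinearMap.flip (Q.brAux d e)) (by
      intro y hy
      rw [LinearMap.mem_ker]
      ext x
      refine Q.cls_eq_zero _ ?_
      have h := Q.comm_mem x.2 (Submodule.mem_comap.1 hy)
      rwa [← add_sub_assoc] at h)))
    (by
      intro x hx
      rw [LinearMap.mem_ker]
      refine LinearMap.ext fun y => ?_
      obtain ⟨y, rfl⟩ := Q.cls_surjective e y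
      refine Q.cls_eq_zero _ ?_
      have h := Q.comm_mem (Submodule.mem_comap.1 hx) y.2
      rwa [sub_add_eq_add_sub] at h)

theorem pieceBr_cls {d e : ℤ} (x : ↥(Q.F d)) (y : ↥(Q.F e)) :
    Q.pieceBr d e (Q.cls d x) (Q.cls e y)
      = Q.cls (d + e - 1) ⟨x.1 * y.1 - y.1 * x.1, Q.comm_mem x.2 y.2⟩ := rfl

instance instGOne : GradedMonoid.GOne Q.Piece where
  one := Q.cls 0 ⟨1, Q.one_mem⟩

instance instGMul : GradedMonoid.GMul Q.Piece where
  mul x y := Q.pieceMul _ _ x y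

instance instGCommRing : DirectSum.GCommRing Q.Piece where
  toGMul := Q.instGMul
  toGOne := Q.instGOne
  mul_zero x := map_zero _
  zero_mul y := LinearMap.map_zero₂ (Q.pieceMul _ _) y
  mul_add x y z := map_add _ _ _
  add_mul x y z := LinearMap.map_add₂ (Q.pieceMul _ _) x y z
  one_mul := by
    rintro ⟨d, x⟩
    obtain ⟨x, rfl⟩ := Q.cls_surjective d x
    exact Q.mk_cls_congr (zero_add d) _ _ (_root_.one_mul _)
  mul_one := by
    rintro ⟨d, x⟩
    obtain ⟨x, rfl⟩ := Q.cls_surjective d x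
    exact Q.mk_cls_congr (add_zero d) _ _ (_root_.mul_one _)
  mul_assoc := by
    rintro ⟨d, x⟩ ⟨e, y⟩ ⟨f, z⟩
    obtain ⟨x, rfl⟩ := Q.cls_surjective d x
    obtain ⟨y, rfl⟩ := Q.cls_surjective e y
    obtain ⟨z, rfl⟩ := Q.cls_surjective f z
    exact Q.mk_cls_congr (add_assoc d e f) _ _ (_root_.mul_assoc _ _ _)
  mul_comm := by
    rintro ⟨d, x⟩ ⟨e, y⟩
    obtain ⟨x, rfl⟩ := Q.cls_surjective d x
    obtain ⟨y, rfl⟩ := Q.cls_surjective e y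
    have hyx : y.1 * x.1 ∈ Q.F (d + e) := by
      rw [add_comm d e]; exact Q.mul_mem y.2 x.2
    refine Eq.trans ?_ (Q.mk_cls_congr (add_comm d e) hyx (Q.mul_mem y.2 x.2) rfl)
    exact congrArg _ (Q.cls_congr _ _ (Q.comm_mem x.2 y.2))
  natCast k := k • Q.cls 0 ⟨1, Q.one_mem⟩
  natCast_zero := zero_smul _ _
  natCast_succ k := succ_nsmul _ _
  intCast k := k • Q.cls 0 ⟨1, Q.one_mem⟩
  intCast_ofNat k := natCast_zsmul _ _
  intCast_negSucc_ofNat k := negSucc_zsmul _ _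

instance instGAlgebra : DirectSum.GAlgebra ℂ Q.Piece where
  toFun := (LinearMap.toSpanSingleton ℂ _ (Q.cls 0 ⟨1, Q.one_mem⟩)).toAddMonoidHom
  map_one := one_smul ℂ (Q.cls 0 ⟨1, Q.one_mem⟩)
  map_mul r s := by
    refine Q.mk_cls_congr (x := (r * s) • (1 : A)) (y := (r • (1 : A)) * (s • (1 : A)))
      (zero_add 0).symm ((Q.F 0).smul_mem _ Q.one_mem)
      (Q.mul_mem ((Q.F 0).smul_mem _ Q.one_mem) ((Q.F 0).smul_mem _ Q.one_mem)) ?_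
    simp [smul_smul, mul_comm]
  commutes r := by
    rintro ⟨d, x⟩
    obtain ⟨x, rfl⟩ := Q.cls_surjective d x
    exact Q.mk_cls_congr (x := (r • (1 : A)) * x.1) (y := x.1 * (r • (1 : A)))
      (by rw [zero_add, add_zero])
      (Q.mul_mem ((Q.F 0).smul_mem _ Q.one_mem) x.2)
      (Q.mul_mem x.2 ((Q.F 0).smul_mem _ Q.one_mem)) (by simp)
  smul_def r := by
    rintro ⟨d, x⟩
    obtain ⟨x, rfl⟩ := Q.cls_surjective d x
    exact Q.mk_cls_congr (x := r • x.1) (y := (r • (1 : A)) * x.1)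
      (zero_add d).symm ((Q.F d).smul_mem _ x.2)
      (Q.mul_mem ((Q.F 0).smul_mem _ Q.one_mem) x.2) (by simp)

/-- The associated graded algebra `⨁ d, F d / F (d - 1)`. -/
abbrev Gr : Type := ⨁ d : ℤ, Q.Piece d

/-- The symbol in degree `d` of an element of `F d`. -/
def sym (d : ℤ) (x : A) (hx : x ∈ Q.F d) : Q.Gr :=
  DirectSum.lof ℂ ℤ Q.Piece d (Q.cls d ⟨x, hx⟩)

/-- The bracket of the associated graded algebra, which sends the symbols of
`x ∈ F d` and `y ∈ F e` to the symbol of `x * y - y * x ∈ F (d + e - 1)`. -/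
def bracket : Q.Gr →ₗ[ℂ] Q.Gr →ₗ[ℂ] Q.Gr :=
  DirectSum.toModule ℂ ℤ _ fun d =>
    LinearMap.flip <| DirectSum.toModule ℂ ℤ _ fun e =>
      LinearMap.flip <|
        (Q.pieceBr d e).compr₂ (DirectSum.lof ℂ ℤ Q.Piece (d + e - 1))

theorem bracket_sym {d e : ℤ} {x y : A} (hx : x ∈ Q.F d) (hy : y ∈ Q.F e) :
    Q.bracket (Q.sym d x hx) (Q.sym e y hy)
      = Q.sym (d + e - 1) (x * y - y * x) (Q.comm_mem hx hy) := by
  simp [bracket, sym, pieceBr_cls]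

theorem sym_mul_sym {d e : ℤ} {x y : A} (hx : x ∈ Q.F d) (hy : y ∈ Q.F e) :
    Q.sym d x hx * Q.sym e y hy = Q.sym (d + e) (x * y) (Q.mul_mem hx hy) := by
  exact DirectSum.of_mul_of _ _

theorem gr_induction {P : Q.Gr → Prop} (zero : P 0)
    (sym : ∀ (d : ℤ) (x : A) (hx : x ∈ Q.F d), P (Q.sym d x hx))
    (add : ∀ x y, P x → P y → P (x + y)) (x : Q.Gr) : P x := by
  induction x using DirectSum.induction_on with
  | zero => exact zero
  | of d x =>
    obtain ⟨x, rfl⟩ := Q.cls_surjective d x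
    exact sym d x.1 x.2
  | add x y hx hy => exact add x y hx hy

end

section

variable {A B : Type} [Ring A] [Algebra ℂ A] [Ring B] [Algebra ℂ B]
  (Q : QFiltration A) (R : QFiltration B)

/-- The map induced on homogeneous components by a filtered homomorphism. -/
def pieceMap (f : A →ₐ[ℂ] B) (hf : ∀ d, ∀ x ∈ Q.F d, f x ∈ R.F d) (d : ℤ) :
    Q.Piece d →ₗ[ℂ] R.Piece d :=
  Submodule.mapQ _ _ (f.toLinearMap.restrict (hf d)) (fun x hx => hf (d - 1) x.1 hx)

/-- The homomorphism of associated graded algebras induced by a filtered homomorphism. -/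
def grMap (f : A →ₐ[ℂ] B) (hf : ∀ d, ∀ x ∈ Q.F d, f x ∈ R.F d) : Q.Gr →ₐ[ℂ] R.Gr :=
  DirectSum.toAlgebra ℂ Q.Piece
    (fun d => (DirectSum.lof ℂ ℤ R.Piece d).comp (Q.pieceMap R f hf d))
    (by
      change R.sym 0 (f 1) (hf 0 1 Q.one_mem) = R.sym 0 1 R.one_mem
      congr 1
      exact map_one f)
    (by
      intro d e x y
      obtain ⟨x, rfl⟩ := Q.cls_surjective d x
      obtain ⟨y, rfl⟩ := Q.cls_surjective e y
      change R.sym (d + e) (f (x.1 * y.1)) (hf _ _ (Q.mul_mem x.2 y.2))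
        = R.sym d (f x.1) (hf _ _ x.2) * R.sym e (f y.1) (hf _ _ y.2)
      rw [sym_mul_sym]
      congr 1
      exact map_mul f _ _)

theorem grMap_sym (f : A →ₐ[ℂ] B) (hf : ∀ d, ∀ x ∈ Q.F d, f x ∈ R.F d)
    {d : ℤ} {x : A} (hx : x ∈ Q.F d) :
    Q.grMap R f hf (Q.sym d x hx) = R.sym d (f x) (hf d x hx) := by
  simp only [grMap, sym, DirectSum.toAlgebra_apply, DirectSum.lof_eq_of]
  erw [DirectSum.toSemiring_of]
  rfl

theorem grMap_bracket (f : A →ₐ[ℂ] B) (hf : ∀ d, ∀ x ∈ Q.F d, f x ∈ R.F d) (x y : Q.Gr) :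
    Q.grMap R f hf (Q.bracket x y) = R.bracket (Q.grMap R f hf x) (Q.grMap R f hf y) := by
  induction x using Q.gr_induction with
  | zero => simp
  | add x x' hx hx' => simp [hx, hx']
  | sym d x hx =>
    induction y using Q.gr_induction with
    | zero => simp
    | add y y' hy hy' => simp [hy, hy']
    | sym e y hy =>
      rw [bracket_sym, grMap_sym, grMap_sym, grMap_sym, bracket_sym]
      congr 1
      simp

end

end QFiltration

/-! ### Poisson brackets and inverse limits -/

/-- A `ℂ`-bilinear operation on a commutative `ℂ`-algebra is a Poisson bracket if it is a Lie
bracket and a derivation in each argument. -/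
structure IsPoissonBracket {A : Type} [CommRing A] [Algebra ℂ A]
    (br : A →ₗ[ℂ] A →ₗ[ℂ] A) : Prop where
  self : ∀ x, br x x = 0
  jacobi : ∀ x y z, br x (br y z) + br y (br z x) + br z (br x y) = 0
  leibniz : ∀ x y z, br x (y * z) = br x y * z + y * br x z

section InvLimit

variable {A : ℕ → Type} [∀ N, CommRing (A N)] [∀ N, Algebra ℂ (A N)]

/-- The inverse limit of a sequence `⋯ → A 2 → A 1 → A 0` of algebras. -/
def invLimit (π : ∀ N, A (N + 1) →ₐ[ℂ] A N) : Subalgebra ℂ (∀ N, A N) where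
  carrier := {x | ∀ N, π N (x (N + 1)) = x N}
  mul_mem' hx hy N := by simp [hx N, hy N]
  add_mem' hx hy N := by simp [hx N, hy N]
  algebraMap_mem' c N := by simp

/-- The componentwise bracket on an inverse limit of algebras with compatible brackets. -/
def invLimitBracket (π : ∀ N, A (N + 1) →ₐ[ℂ] A N) (br : ∀ N, A N →ₗ[ℂ] A N →ₗ[ℂ] A N)
    (h : ∀ N x y, π N (br (N + 1) x y) = br N (π N x) (π N y)) :
    invLimit π →ₗ[ℂ] invLimit π →ₗ[ℂ] invLimit π :=
  LinearMap.mk₂ ℂ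
    (fun x y => ⟨fun N => br N (x.1 N) (y.1 N), fun N => by rw [h, x.2 N, y.2 N]⟩)
    (fun x x' y => by ext N; simp)
    (fun c x y => by ext N; simp)
    (fun x y y' => by ext N; simp)
    (fun c x y => by ext N; simp)

end InvLimit

/-! ### The algebras `Y^rtt(gl_n)_N` -/

namespace Yangian

/-- Indices `(i, j, r)` of the generators `t_ij^(r)` with arbitrary `r : ℤ`. -/
abbrev Letter (n : ℕ) : Type := Fin n × Fin n × ℤ

/-- The relations
`[t_ij^(p+1), t_kl^(q)] - [t_ij^(p), t_kl^(q+1)] = t_kj^(q) t_il^(p) - t_kj^(p) t_il^(q)`. -/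
inductive PolRel (n : ℕ) : FreeAlgebra ℂ (Letter n) → FreeAlgebra ℂ (Letter n) → Prop
  | rtt (i j k l : Fin n) (p q : ℤ) :
      PolRel n
        ((FreeAlgebra.ι ℂ (i, j, p + 1) * FreeAlgebra.ι ℂ (k, l, q)
            - FreeAlgebra.ι ℂ (k, l, q) * FreeAlgebra.ι ℂ (i, j, p + 1))
          - (FreeAlgebra.ι ℂ (i, j, p) * FreeAlgebra.ι ℂ (k, l, q + 1)
            - FreeAlgebra.ι ℂ (k, l, q + 1) * FreeAlgebra.ι ℂ (i, j, p)))
        (FreeAlgebra.ι ℂ (k, j, q) * FreeAlgebra.ι ℂ (i, l, p)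
          - FreeAlgebra.ι ℂ (k, j, p) * FreeAlgebra.ι ℂ (i, l, q))

/-- The algebra `Y^rtt(gl_n)^pol`. -/
def YPol (n : ℕ) : Type := RingQuot (PolRel n)

instance (n : ℕ) : Ring (YPol n) := inferInstanceAs (Ring (RingQuot (PolRel n)))

instance (n : ℕ) : Algebra ℂ (YPol n) := inferInstanceAs (Algebra ℂ (RingQuot (PolRel n)))

/-- The generator `t_ij^(r)` of `Y^rtt(gl_n)^pol`. -/
def tPol (n : ℕ) (i j : Fin n) (r : ℤ) : YPol n :=
  RingQuot.mkAlgHom ℂ (PolRel n) (FreeAlgebra.ι ℂ (i, j, r))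

/-- The relations `t_ij^(-r) = 0` for `r > N`, generating the two-sided ideal `I_N`. -/
inductive TruncRel (n N : ℕ) : YPol n → YPol n → Prop
  | trunc (i j : Fin n) (r : ℤ) (hr : (N : ℤ) < r) : TruncRel n N (tPol n i j (-r)) 0

/-- The algebra `Y^rtt(gl_n)_N`, the quotient of `Y^rtt(gl_n)^pol` by the two-sided ideal
`I_N` generated by the elements `t_ij^(-r)` with `r > N`. -/
def Y (n N : ℕ) : Type := RingQuot (TruncRel n N)

instance (n N : ℕ) : Ring (Y n N) := inferInstanceAs (Ring (RingQuot (TruncRel n N)))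

instance (n N : ℕ) : Algebra ℂ (Y n N) := inferInstanceAs (Algebra ℂ (RingQuot (TruncRel n N)))

/-- The quotient map from `Y^rtt(gl_n)^pol` to `Y^rtt(gl_n)_N`. -/
def proj (n N : ℕ) : YPol n →ₐ[ℂ] Y n N := RingQuot.mkAlgHom ℂ (TruncRel n N)

/-- The image of `t_ij^(r)` in `Y^rtt(gl_n)_N`. -/
def t (n N : ℕ) (i j : Fin n) (r : ℤ) : Y n N := proj n N (tPol n i j r)

theorem tPol_rel (n : ℕ) (i j k l : Fin n) (p q : ℤ) :
    (tPol n i j (p + 1) * tPol n k l q - tPol n k l q * tPol n i j (p + 1))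
      - (tPol n i j p * tPol n k l (q + 1) - tPol n k l (q + 1) * tPol n i j p)
    = tPol n k j q * tPol n i l p - tPol n k j p * tPol n i l q := by
  have h := RingQuot.mkAlgHom_rel ℂ (PolRel.rtt i j k l p q)
  simp only [map_sub, map_mul] at h
  exact h

theorem t_rel (n N : ℕ) (i j k l : Fin n) (p q : ℤ) :
    (t n N i j (p + 1) * t n N k l q - t n N k l q * t n N i j (p + 1))
      - (t n N i j p * t n N k l (q + 1) - t n N k l (q + 1) * t n N i j p)
    = t n N k j q * t n N i l p - t n N k j p * t n N i l q := by
  have h := congrArg (proj n N) (tPol_rel n i j k l p q)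
  simp only [map_sub, map_mul] at h
  exact h

theorem t_eq_zero (n N : ℕ) (i j : Fin n) {r : ℤ} (hr : r < -(N : ℤ)) : t n N i j r = 0 := by
  have h := RingQuot.mkAlgHom_rel ℂ (TruncRel.trunc i j (-r) (by omega) : TruncRel n N _ _)
  rw [neg_neg, map_zero] at h
  exact h

/-- The product `t_{i₁j₁}^(r₁) ⋯ t_{iₘjₘ}^(rₘ)` attached to a word. -/
def word (n N : ℕ) (w : List (Letter n)) : Y n N :=
  (w.map fun a => t n N a.1 a.2.1 a.2.2).prod

/-- The degree `r₁ + ⋯ + rₘ` of a word. -/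
def wordDeg {n : ℕ} (w : List (Letter n)) : ℤ := (w.map fun a => a.2.2).sum

/-- The filtration of `Y^rtt(gl_n)_N` in which `t_ij^(r)` has degree `r`. -/
def fil (n N : ℕ) (d : ℤ) : Submodule ℂ (Y n N) :=
  Submodule.span ℂ {x | ∃ w : List (Letter n), wordDeg w ≤ d ∧ word n N w = x}

theorem word_mem_fil (n N : ℕ) {w : List (Letter n)} {d : ℤ} (h : wordDeg w ≤ d) :
    word n N w ∈ fil n N d :=
  Submodule.subset_span ⟨w, h, rfl⟩

theorem fil_mono (n N : ℕ) : Monotone (fil n N) := fun _ _ h =>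
  Submodule.span_mono fun _ ⟨w, hw, e⟩ => ⟨w, hw.trans h, e⟩

theorem one_mem_fil (n N : ℕ) : (1 : Y n N) ∈ fil n N 0 :=
  word_mem_fil n N (w := []) le_rfl

theorem t_mem_fil (n N : ℕ) (i j : Fin n) (r : ℤ) : t n N i j r ∈ fil n N r := by
  have h := word_mem_fil n N (w := [(i, j, r)]) (d := r) (by simp [wordDeg])
  simpa [word] using h

theorem mul_mem_fil (n N : ℕ) {d e : ℤ} {x y : Y n N} (hx : x ∈ fil n N d)
    (hy : y ∈ fil n N e) : x * y ∈ fil n N (d + e) := by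
  refine Submodule.mul_le.1 (?_ : fil n N d * fil n N e ≤ fil n N (d + e)) x hx y hy
  rw [fil, fil, Submodule.span_mul_span, Submodule.span_le]
  rintro _ ⟨_, ⟨v, hv, rfl⟩, _, ⟨w, hw, rfl⟩, rfl⟩
  have h := word_mem_fil n N (w := v ++ w) (d := d + e) (by
    simp only [wordDeg, List.map_append, List.sum_append] at hv hw ⊢
    omega)
  simpa [word] using h

theorem t_comm_mem (n N : ℕ) (i j k l : Fin n) (p q : ℤ) :
    t n N i j p * t n N k l q - t n N k l q * t n N i j p ∈ fil n N (p + q - 1) := by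
  rcases lt_or_ge p (-(N : ℤ)) with hp | hp
  · simp [t_eq_zero n N i j hp]
  have key : ∀ p : ℤ, -(N : ℤ) - 1 ≤ p → ∀ q : ℤ,
      t n N i j p * t n N k l q - t n N k l q * t n N i j p ∈ fil n N (p + q - 1) := by
    intro p hp
    induction p, hp using Int.leInduction with
    | base =>
      intro q
      simp [t_eq_zero n N i j (show -(N : ℤ) - 1 < -(N : ℤ) by omega)]
    | succ p hp ih =>
      intro q
      rw [sub_eq_iff_eq_add.1 (t_rel n N i j k l p q)]
      refine add_mem (sub_mem ?_ ?_) ?_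
      · exact fil_mono n N (by omega) (mul_mem_fil n N (t_mem_fil n N k j q) (t_mem_fil n N i l p))
      · exact fil_mono n N (by omega) (mul_mem_fil n N (t_mem_fil n N k j p) (t_mem_fil n N i l q))
      · exact fil_mono n N (by omega) (ih (q + 1))
  exact key p (by omega) q

theorem t_word_comm_mem (n N : ℕ) (i j : Fin n) (r : ℤ) (w : List (Letter n)) :
    t n N i j r * word n N w - word n N w * t n N i j r ∈ fil n N (r + wordDeg w - 1) := by
  induction w with
  | nil => simp [word]
  | cons a w ih =>
    have e : t n N i j r * word n N (a :: w) - word n N (a :: w) * t n N i j r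
        = (t n N i j r * t n N a.1 a.2.1 a.2.2 - t n N a.1 a.2.1 a.2.2 * t n N i j r) * word n N w
          + t n N a.1 a.2.1 a.2.2 * (t n N i j r * word n N w - word n N w * t n N i j r) := by
      simp only [word, List.map_cons, List.prod_cons]
      noncomm_ring
    have hd : wordDeg (a :: w) = a.2.2 + wordDeg w := by simp [wordDeg]
    rw [e, hd]
    refine add_mem ?_ ?_
    · exact fil_mono n N (by omega) (mul_mem_fil n N (t_comm_mem n N i j _ _ r _)
        (word_mem_fil n N le_rfl))
    · exact fil_mono n N (by omega) (mul_mem_fil n N (t_mem_fil n N _ _ _) ih)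

theorem word_comm_mem (n N : ℕ) (v w : List (Letter n)) :
    word n N v * word n N w - word n N w * word n N v
      ∈ fil n N (wordDeg v + wordDeg w - 1) := by
  induction v with
  | nil => simp [word]
  | cons a v ih =>
    have e : word n N (a :: v) * word n N w - word n N w * word n N (a :: v)
        = t n N a.1 a.2.1 a.2.2 * (word n N v * word n N w - word n N w * word n N v)
          + (t n N a.1 a.2.1 a.2.2 * word n N w - word n N w * t n N a.1 a.2.1 a.2.2)
            * word n N v := by
      simp only [word, List.map_cons, List.prod_cons]
      noncomm_ring
    have hd : wordDeg (a :: v) = a.2.2 + wordDeg v := by simp [wordDeg]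
    rw [e, hd]
    refine add_mem ?_ ?_
    · exact fil_mono n N (by omega) (mul_mem_fil n N (t_mem_fil n N _ _ _) ih)
    · exact fil_mono n N (by omega) (mul_mem_fil n N (t_word_comm_mem n N _ _ _ w)
        (word_mem_fil n N le_rfl))

theorem comm_mem_fil (n N : ℕ) {d e : ℤ} {x y : Y n N} (hx : x ∈ fil n N d)
    (hy : y ∈ fil n N e) : x * y - y * x ∈ fil n N (d + e - 1) := by
  induction hx using Submodule.span_induction with
  | zero => simp
  | add x x' _ _ h h' =>
    have e : (x + x') * y - y * (x + x') = (x * y - y * x) + (x' * y - y * x') := by noncomm_ring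
    rw [e]; exact add_mem h h'
  | smul c x _ h =>
    rw [smul_mul_assoc, mul_smul_comm, ← smul_sub]
    exact Submodule.smul_mem _ _ h
  | mem x hx =>
    obtain ⟨v, hv, rfl⟩ := hx
    induction hy using Submodule.span_induction with
    | zero => simp
    | add y y' _ _ h h' =>
      have e : word n N v * (y + y') - (y + y') * word n N v
          = (word n N v * y - y * word n N v) + (word n N v * y' - y' * word n N v) := by
        noncomm_ring
      rw [e]; exact add_mem h h'
    | smul c y _ h =>
      rw [smul_mul_assoc, mul_smul_comm, ← smul_sub]
      exact Submodule.smul_mem _ _ h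
    | mem y hy =>
      obtain ⟨w, hw, rfl⟩ := hy
      exact fil_mono n N (by omega) (word_comm_mem n N v w)

/-- The filtered algebra `Y^rtt(gl_n)_N`, with `t_ij^(r)` in degree `r`. -/
def filtration (n N : ℕ) : QFiltration (Y n N) where
  F := fil n N
  mono := fil_mono n N
  one_mem := one_mem_fil n N
  mul_mem := mul_mem_fil n N
  comm_mem := comm_mem_fil n N

theorem t_mem_filtration (n N : ℕ) (i j : Fin n) (r : ℤ) :
    t n N i j r ∈ (filtration n N).F r :=
  t_mem_fil n N i j r

/-- The algebra `gr Y^rtt(gl_n)_N`. -/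
abbrev GrY (n N : ℕ) : Type := (filtration n N).Gr

/-- The Poisson bracket of `gr Y^rtt(gl_n)_N`, induced by the commutator. -/
def grYBracket (n N : ℕ) : GrY n N →ₗ[ℂ] GrY n N →ₗ[ℂ] GrY n N := (filtration n N).bracket

/-- The element `gr t_ij^(r)` of `gr Y^rtt(gl_n)_N`, in degree `r`. -/
def grT (n N : ℕ) (i j : Fin n) (r : ℤ) : GrY n N :=
  (filtration n N).sym r (t n N i j r) (t_mem_filtration n N i j r)

/-- The projection from `Y^rtt(gl_n)_(N+1)` to `Y^rtt(gl_n)_N`. -/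
def trans (n N : ℕ) : Y n (N + 1) →ₐ[ℂ] Y n N :=
  RingQuot.liftAlgHom ℂ ⟨proj n N, by
    rintro _ _ ⟨i, j, r, hr⟩
    rw [map_zero]
    exact t_eq_zero n N i j (by push_cast at hr; omega)⟩

theorem trans_t (n N : ℕ) (i j : Fin n) (r : ℤ) : trans n N (t n (N + 1) i j r) = t n N i j r :=
  RingQuot.liftAlgHom_mkAlgHom_apply ℂ (proj n N) _ _

theorem trans_word (n N : ℕ) (w : List (Letter n)) :
    trans n N (word n (N + 1) w) = word n N w := by
  simp [word, map_list_prod, trans_t, Function.comp_def]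

theorem trans_mem (n N : ℕ) (d : ℤ) (x : Y n (N + 1)) (hx : x ∈ (filtration n (N + 1)).F d) :
    trans n N x ∈ (filtration n N).F d := by
  refine (Submodule.span_le (p := (fil n N d).comap (trans n N).toLinearMap)).2 ?_ hx
  rintro _ ⟨w, hw, rfl⟩
  change trans n N (word n (N + 1) w) ∈ fil n N d
  rw [trans_word]
  exact word_mem_fil n N hw

/-- The projection from `gr Y^rtt(gl_n)_(N+1)` to `gr Y^rtt(gl_n)_N`. -/
def grTrans (n N : ℕ) : GrY n (N + 1) →ₐ[ℂ] GrY n N :=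
  (filtration n (N + 1)).grMap (filtration n N) (trans n N) (trans_mem n N)

theorem grTrans_grT (n N : ℕ) (i j : Fin n) (r : ℤ) :
    grTrans n N (grT n (N + 1) i j r) = grT n N i j r := by
  unfold grTrans grT
  rw [QFiltration.grMap_sym]
  congr 1
  exact trans_t n N i j r

theorem grTrans_bracket (n N : ℕ) (x y : GrY n (N + 1)) :
    grTrans n N (grYBracket n (N + 1) x y)
      = grYBracket n N (grTrans n N x) (grTrans n N y) :=
  QFiltration.grMap_bracket _ _ _ _ x y

/-- The algebra `gr Y^rtt(gl_n)`, the inverse limit of the algebras `gr Y^rtt(gl_n)_N`. -/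
abbrev GrYLim (n : ℕ) : Type := invLimit (A := GrY n) (grTrans n)

/-- The Poisson bracket of `gr Y^rtt(gl_n)`. -/
def grYLimBracket (n : ℕ) : GrYLim n →ₗ[ℂ] GrYLim n →ₗ[ℂ] GrYLim n :=
  invLimitBracket (A := GrY n) (grTrans n) (grYBracket n) (grTrans_bracket n)

/-- The element `gr t_ij^(r)` of `gr Y^rtt(gl_n)`. -/
def grTLim (n : ℕ) (i j : Fin n) (r : ℤ) : GrYLim n :=
  ⟨fun N => grT n N i j r, fun N => grTrans_grT n N i j r⟩

/-- Indices `(i, j, r)` with `r ≥ -N`. -/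
structure Gen (n N : ℕ) where
  i : Fin n
  j : Fin n
  r : ℤ
  hr : -(N : ℤ) ≤ r

/-- The product of the elements `t_ij^(r)`, `(i, j, r) ∈ s`, in increasing order, for a multiset
`s` of indices with `r ≥ -N`. -/
def orderedMonomial {n N : ℕ} [LinearOrder (Gen n N)] (s : Multiset (Gen n N)) : Y n N :=
  ((s.sort (· ≤ ·)).map fun g => t n N g.i g.j g.r).prod

/-! ### The Poisson algebra of functions on `Mat_n((z⁻¹))` -/

/-- The coordinate ring of `z^N Mat_n[[z⁻¹]]`, an affine space with one coordinate `Δ_ij^(r)`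
for each `i, j` and each `r ≥ -N`: the coefficient of `z^(-r)` in the `(i, j)` entry. -/
abbrev OMat (n N : ℕ) : Type := MvPolynomial (Gen n N) ℂ

/-- The function `Δ_ij^(r)` on `z^N Mat_n[[z⁻¹]]`, which vanishes for `r < -N`. -/
noncomputable def Δ (n N : ℕ) (i j : Fin n) (r : ℤ) : OMat n N :=
  if h : -(N : ℤ) ≤ r then MvPolynomial.X ⟨i, j, r, h⟩ else 0

/-- The bracket `{Δ_ij^(p), Δ_kl^(q)}` on `z^N Mat_n[[z⁻¹]]`, which is
`∑_{a < min p q} (Δ_il^(a) Δ_kj^(p+q-1-a) - Δ_kj^(a) Δ_il^(p+q-1-a))`. -/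
noncomputable def bracketΔ (n N : ℕ) (i j : Fin n) (p : ℤ) (k l : Fin n) (q : ℤ) : OMat n N :=
  ∑ a ∈ Finset.Ico (-(N : ℤ)) (min p q),
    (Δ n N i l a * Δ n N k j (p + q - 1 - a) - Δ n N k j a * Δ n N i l (p + q - 1 - a))

/-- The bracket of functions on `z^N Mat_n[[z⁻¹]]`: the extension of `bracketΔ` to a derivation
in each argument. -/
noncomputable def OMatBracket (n N : ℕ) : OMat n N →ₗ[ℂ] OMat n N →ₗ[ℂ] OMat n N :=
  LinearMap.mk₂ ℂ
    (fun f g => MvPolynomial.mkDerivation ℂ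
      (fun a : Gen n N => MvPolynomial.mkDerivation ℂ
        (fun b : Gen n N => bracketΔ n N a.i a.j a.r b.i b.j b.r) g) f)
    (fun f f' g => map_add _ _ _)
    (fun c f g => Derivation.map_smul _ _ _)
    (fun f g g' => by
      rw [← Derivation.add_apply]
      congr 1
      refine MvPolynomial.derivation_ext fun a => ?_
      simp [MvPolynomial.mkDerivation_X])
    (fun c f g => by
      rw [← Derivation.smul_apply]
      congr 1
      refine MvPolynomial.derivation_ext fun a => ?_
      simp [MvPolynomial.mkDerivation_X])

theorem OMatBracket_apply (n N : ℕ) (f g : OMat n N) :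
    OMatBracket n N f g = MvPolynomial.mkDerivation ℂ
      (fun a : Gen n N => MvPolynomial.mkDerivation ℂ
        (fun b : Gen n N => bracketΔ n N a.i a.j a.r b.i b.j b.r) g) f := rfl

theorem OMatBracket_leibniz_left (n N : ℕ) (f f' g : OMat n N) :
    OMatBracket n N (f * f') g = f * OMatBracket n N f' g + f' * OMatBracket n N f g := by
  simp only [OMatBracket_apply, Derivation.leibniz, smul_eq_mul]

theorem OMatBracket_leibniz_right (n N : ℕ) (f g g' : OMat n N) :
    OMatBracket n N f (g * g') = g * OMatBracket n N f g' + g' * OMatBracket n N f g := by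
  simp only [OMatBracket_apply, ← smul_eq_mul (α := OMat n N)]
  rw [← Derivation.smul_apply, ← Derivation.smul_apply, ← Derivation.add_apply]
  congr 1
  refine MvPolynomial.derivation_ext fun a => ?_
  simp [MvPolynomial.mkDerivation_X]

theorem OMatBracket_C_right (n N : ℕ) (f : OMat n N) (c : ℂ) :
    OMatBracket n N f (MvPolynomial.C c) = 0 := by
  have h : OMatBracket n N f 1 = 0 := by
    have h1 := OMatBracket_leibniz_right n N f 1 1
    simpa using h1
  rw [← mul_one (MvPolynomial.C c), ← MvPolynomial.smul_eq_C_mul, map_smul, h, smul_zero]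

theorem OMatBracket_C_left (n N : ℕ) (c : ℂ) (g : OMat n N) :
    OMatBracket n N (MvPolynomial.C c) g = 0 := by
  rw [OMatBracket_apply, MvPolynomial.derivation_C]

theorem OMatBracket_X_left (n N : ℕ) (a : Gen n N) (g : OMat n N) :
    OMatBracket n N (MvPolynomial.X a) g = MvPolynomial.mkDerivation ℂ
      (fun b : Gen n N => bracketΔ n N a.i a.j a.r b.i b.j b.r) g := by
  rw [OMatBracket_apply, MvPolynomial.mkDerivation_X]

theorem OMatBracket_X_X (n N : ℕ) (a b : Gen n N) :
    OMatBracket n N (MvPolynomial.X a) (MvPolynomial.X b)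
      = bracketΔ n N a.i a.j a.r b.i b.j b.r := by
  rw [OMatBracket_X_left, MvPolynomial.mkDerivation_X]

theorem Δ_gen (n N : ℕ) (g : Gen n N) : Δ n N g.i g.j g.r = MvPolynomial.X g :=
  dif_pos g.hr

theorem Δ_eq_zero (n N : ℕ) (i j : Fin n) {r : ℤ} (hr : r < -(N : ℤ)) : Δ n N i j r = 0 :=
  dif_neg (not_le.2 hr)

theorem OMatBracket_Δ (n N : ℕ) (i j : Fin n) (p : ℤ) (k l : Fin n) (q : ℤ) :
    OMatBracket n N (Δ n N i j p) (Δ n N k l q) = bracketΔ n N i j p k l q := by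
  rcases lt_or_ge p (-(N : ℤ)) with hp | hp
  · rw [Δ_eq_zero n N i j hp, map_zero, LinearMap.zero_apply, bracketΔ,
      Finset.Ico_eq_empty (by omega), Finset.sum_empty]
  rcases lt_or_ge q (-(N : ℤ)) with hq | hq
  · rw [Δ_eq_zero n N k l hq, map_zero, bracketΔ,
      Finset.Ico_eq_empty (by omega), Finset.sum_empty]
  exact (congrArg₂ (fun x y => OMatBracket n N x y) (Δ_gen n N ⟨i, j, p, hp⟩)
    (Δ_gen n N ⟨k, l, q, hq⟩)).trans (OMatBracket_X_X n N _ _)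

/-- The defining relations of the bracket:
`{Δ_ij^(p+1), Δ_kl^(q)} - {Δ_ij^(p), Δ_kl^(q+1)} = Δ_il^(p) Δ_kj^(q) - Δ_kj^(p) Δ_il^(q)`.
Since `Δ_ij^(r) = 0` for `r < -N`, they determine all `{Δ_ij^(p), Δ_kl^(q)}`. -/
theorem OMatBracket_rel (n N : ℕ) (i j k l : Fin n) (p q : ℤ) :
    OMatBracket n N (Δ n N i j (p + 1)) (Δ n N k l q)
      - OMatBracket n N (Δ n N i j p) (Δ n N k l (q + 1))
    = Δ n N i l p * Δ n N k j q - Δ n N k j p * Δ n N i l q := by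
  simp only [OMatBracket_Δ, bracketΔ]
  have e : p + (q + 1) - 1 = p + 1 + q - 1 := by ring
  rw [e]
  have top : ∀ (m : ℤ) (f : ℤ → OMat n N), (m < -(N : ℤ) → f m = 0) →
      ∑ a ∈ Finset.Ico (-(N : ℤ)) (m + 1), f a = ∑ a ∈ Finset.Ico (-(N : ℤ)) m, f a + f m := by
    intro m f hf
    rcases lt_or_ge m (-(N : ℤ)) with hm | hm
    · rw [hf hm, Finset.Ico_eq_empty (by omega), Finset.Ico_eq_empty (by omega), Finset.sum_empty,
        add_zero]
    · have hI : Finset.Ico (-(N : ℤ)) (m + 1) = insert m (Finset.Ico (-(N : ℤ)) m) := by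
        ext x; simp only [Finset.mem_Ico, Finset.mem_insert]; omega
      rw [hI, Finset.sum_insert (by simp), add_comm]
  rcases lt_trichotomy p q with h | h | h
  · rw [min_eq_left (show p + 1 ≤ q by omega), min_eq_left (show p ≤ q + 1 by omega), top p]
    · rw [show p + 1 + q - 1 - p = q by ring]; ring
    · intro hp; simp [Δ_eq_zero n N _ _ hp]
  · subst h
    rw [min_eq_right (show p ≤ p + 1 by omega), min_eq_left (show p ≤ p + 1 by omega)]
    ring
  · rw [min_eq_right (show q ≤ p + 1 by omega), min_eq_right (show q + 1 ≤ p by omega), top q]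
    · rw [show p + 1 + q - 1 - q = p by ring]; ring
    · intro hq; simp [Δ_eq_zero n N _ _ hq]

/-- Restriction of functions from `z^(N+1) Mat_n[[z⁻¹]]` to `z^N Mat_n[[z⁻¹]]`. -/
noncomputable def OMatTrans (n N : ℕ) : OMat n (N + 1) →ₐ[ℂ] OMat n N :=
  MvPolynomial.aeval fun g => Δ n N g.i g.j g.r

theorem OMatTrans_Δ (n N : ℕ) (i j : Fin n) (r : ℤ) :
    OMatTrans n N (Δ n (N + 1) i j r) = Δ n N i j r := by
  rcases lt_or_ge r (-((N + 1 : ℕ) : ℤ)) with hr | hr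
  · rw [Δ_eq_zero n (N + 1) i j hr, map_zero, Δ_eq_zero n N i j (by push_cast at hr; omega)]
  · exact (congrArg (OMatTrans n N) (Δ_gen n (N + 1) ⟨i, j, r, hr⟩)).trans
      (MvPolynomial.aeval_X _ _)

theorem OMatTrans_bracketΔ (n N : ℕ) (i j : Fin n) (p : ℤ) (k l : Fin n) (q : ℤ) :
    OMatTrans n N (bracketΔ n (N + 1) i j p k l q) = bracketΔ n N i j p k l q := by
  simp only [bracketΔ, map_sum, map_sub, map_mul, OMatTrans_Δ]
  symm
  apply Finset.sum_subset
  · intro x; simp only [Finset.mem_Ico]; push_cast; omega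
  · intro x hx hx'
    have h : x < -(N : ℤ) := by
      simp only [Finset.mem_Ico] at hx hx'
      push_cast at hx
      omega
    simp [Δ_eq_zero n N _ _ h]

theorem OMatTrans_bracket (n N : ℕ) (f g : OMat n (N + 1)) :
    OMatTrans n N (OMatBracket n (N + 1) f g)
      = OMatBracket n N (OMatTrans n N f) (OMatTrans n N g) := by
  induction f using MvPolynomial.induction_on with
  | C c => simp only [MvPolynomial.algHom_C, OMatBracket_C_left, map_zero,
      MvPolynomial.algebraMap_eq]
  | add f f' hf hf' => simp only [map_add, LinearMap.add_apply, hf, hf']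
  | mul_X f a hf =>
    suffices h : OMatTrans n N (OMatBracket n (N + 1) (MvPolynomial.X a) g)
        = OMatBracket n N (OMatTrans n N (MvPolynomial.X a)) (OMatTrans n N g) by
      simp only [map_mul, OMatBracket_leibniz_left, map_add, hf, h]
    clear hf
    induction g using MvPolynomial.induction_on with
    | C c => simp only [MvPolynomial.algHom_C, OMatBracket_C_right, map_zero,
        MvPolynomial.algebraMap_eq]
    | add g g' hg hg' => simp only [map_add, hg, hg']
    | mul_X g b hg =>
      have h : OMatTrans n N (OMatBracket n (N + 1) (MvPolynomial.X a) (MvPolynomial.X b))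
          = OMatBracket n N (OMatTrans n N (MvPolynomial.X a))
            (OMatTrans n N (MvPolynomial.X b)) := by
        rw [← Δ_gen, ← Δ_gen, OMatTrans_Δ, OMatTrans_Δ, OMatBracket_Δ, OMatBracket_Δ,
          OMatTrans_bracketΔ]
      simp only [map_mul, OMatBracket_leibniz_right, map_add, hg, h]

/-- Evaluation of functions at a point `g` of `z^N Mat_n[[z⁻¹]]`, a matrix of Laurent series in
the variable `z⁻¹` whose coefficients of `(z⁻¹)^r` vanish for `r < -N`. -/
noncomputable def evalAt (n N : ℕ) (g : Matrix (Fin n) (Fin n) (LaurentSeries ℂ)) :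
    OMat n N →ₐ[ℂ] ℂ :=
  MvPolynomial.aeval fun x => (g x.i x.j).coeff x.r

theorem evalAt_Δ (n N : ℕ) (g : Matrix (Fin n) (Fin n) (LaurentSeries ℂ))
    (hg : ∀ i j, ∀ r < -(N : ℤ), (g i j).coeff r = 0) (i j : Fin n) (r : ℤ) :
    evalAt n N g (Δ n N i j r) = (g i j).coeff r := by
  rcases lt_or_ge r (-(N : ℤ)) with hr | hr
  · rw [Δ_eq_zero n N i j hr, map_zero, hg i j r hr]
  · exact (congrArg (evalAt n N g) (Δ_gen n N ⟨i, j, r, hr⟩)).trans (MvPolynomial.aeval_X _ _)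

theorem evalAt_OMatTrans (n N : ℕ) (g : Matrix (Fin n) (Fin n) (LaurentSeries ℂ))
    (hg : ∀ i j, ∀ r < -(N : ℤ), (g i j).coeff r = 0) (f : OMat n (N + 1)) :
    evalAt n N g (OMatTrans n N f) = evalAt n (N + 1) g f := by
  have h : (evalAt n N g).comp (OMatTrans n N) = evalAt n (N + 1) g := by
    refine MvPolynomial.algHom_ext fun a => ?_
    rw [AlgHom.comp_apply, ← Δ_gen, OMatTrans_Δ, evalAt_Δ n N g hg, evalAt_Δ n (N + 1) g]
    intro i j r hr
    exact hg i j r (by push_cast at hr; omega)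
  exact DFunLike.congr_fun h f

/-- The algebra of functions on the ind-scheme `Mat_n((z⁻¹))`, the union of the affine spaces
`z^N Mat_n[[z⁻¹]]`: the inverse limit of their coordinate rings. -/
abbrev OMatLaurent (n : ℕ) : Type := invLimit (A := OMat n) (OMatTrans n)

/-- The Poisson bracket of functions on `Mat_n((z⁻¹))`. -/
noncomputable def OMatLaurentBracket (n : ℕ) :
    OMatLaurent n →ₗ[ℂ] OMatLaurent n →ₗ[ℂ] OMatLaurent n :=
  invLimitBracket (A := OMat n) (OMatTrans n) (OMatBracket n) (OMatTrans_bracket n)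

/-- The function `Δ_ij^(r)` on `Mat_n((z⁻¹))`: the coefficient of `z^(-r)` in the `(i, j)`
entry. -/
noncomputable def ΔLaurent (n : ℕ) (i j : Fin n) (r : ℤ) : OMatLaurent n :=
  ⟨fun N => Δ n N i j r, fun N => OMatTrans_Δ n N i j r⟩

end Yangian

/-! The generators vanish in degrees below `-N`, so the relations can be solved recursively from
there: the commutator of two generators is a finite sum of quadratic words of total degree one less
(`t_mul_t`). Reordering a word therefore changes it by words of the same length and lower degree. At
fixed length `m` the degree is at least `-N * m`, so the process stops and ordered monomials span.

Independence needs a linear map from `Y n N` to polynomials under which every word has its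
commutative monomial as leading term. Dually, a polynomial-valued function of words descends to the
algebra when it is fixed by `pairOp` at each pair of adjacent letters. Now `pairOp` is a
transposition plus terms of lower degree, it is an involution (`pairOp_pairOp`), and it satisfies
the braid relation (`op_braid`), a form of the Yang-Baxter equation for the rational R-matrix. Once
row and column indices are separated, this relation becomes a list of identities between
transpositions and divided differences of triple sequences, and these are checked on the sequences
`a ^ p * b ^ q * c ^ r`.

So the symmetric group on `m` letters acts on functions of words of length `m`, and averaging the
commutative monomial gives an invariant function with the same leading term (`braidOp_symProd`,
`hasLeading_symProd`). The algebra acts on invariant functions by appending letters (`act_mul_act`);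
evaluation at the empty word gives `symMap`, with leading terms as wanted (`symMap_word_sub_mem`).

A linear relation is refuted by its terms of maximal degree. The symbol of `symMap` is a left
inverse of the surjection `ofPoly` from the polynomial algebra onto the associated graded algebra.
Both brackets are biderivations that agree on generators, so `ofPoly` is Poisson, and the polynomial
bracket inherits the Jacobi identity from the commutator. Everything passes to the limit
componentwise. -/

/-! ### Symmetrizers attached to involutions that satisfy the braid relations -/

section Symmetrizer

variable {R : Type*} [Ring R]

/-- The sum `1 + σ k + σ k * σ (k + 1) + ⋯ + σ k * ⋯ * σ (k + m - 1)`. -/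
def braidChain (σ : ℕ → R) : ℕ → ℕ → R
  | 0, _ => 1
  | m + 1, k => 1 + σ k * braidChain σ m (k + 1)

/-- The sum over the symmetric group on `m` letters generated by `σ k, …, σ (k + m - 2)`. -/
def braidSymmetrizer (σ : ℕ → R) : ℕ → ℕ → R
  | 0, _ => 1
  | m + 1, k => braidSymmetrizer σ m (k + 1) * braidChain σ m k

variable {σ : ℕ → R} (comm : ∀ j k, j + 2 ≤ k → σ j * σ k = σ k * σ j)

include comm in
theorem commute_braidChain (m : ℕ) : ∀ j k, j + 2 ≤ k → Commute (σ j) (braidChain σ m k) := by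
  induction m with
  | zero => intro j k _; exact Commute.one_right _
  | succ m ih =>
    intro j k h
    exact (Commute.one_right _).add_right
      (Commute.mul_right (comm j k h) (ih j (k + 1) (by omega)))

include comm in
theorem commute_braidSymmetrizer (m : ℕ) :
    ∀ j k, j + 2 ≤ k → Commute (σ j) (braidSymmetrizer σ m k) := by
  induction m with
  | zero => intro j k _; exact Commute.one_right _
  | succ m ih =>
    intro j k h
    exact Commute.mul_right (ih j (k + 1) (by omega)) (commute_braidChain comm m j k h)

variable (inv : ∀ k, σ k * σ k = 1)
  (braid : ∀ k, σ k * σ (k + 1) * σ k = σ (k + 1) * σ k * σ (k + 1))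

include comm inv braid in
-- This is the only case of invariance that is not formal: the new generator `σ k` against the last
-- two chains of the symmetrizer. Working with chains avoids reduced words in the symmetric group.
theorem mul_braidChain_mul_braidChain (m : ℕ) : ∀ k,
    σ k * (braidChain σ m (k + 1) * braidChain σ (m + 1) k)
      = braidChain σ m (k + 1) * braidChain σ (m + 1) k := by
  induction m with
  | zero => intro k; simp [braidChain, mul_add, inv, add_comm]
  | succ m ih =>
    intro k
    have h := ih (k + 1)
    have hc := (commute_braidChain comm m k (k + 2) le_rfl).eq
    simp only [braidChain] at h ⊢
    set a := σ k with ha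
    set b := σ (k + 1) with hb
    set Z := braidChain σ m (k + 1 + 1)
    have hb' : a * b * a = b * a * b := braid k
    have ha' : a * a = 1 := inv k
    -- The induction hypothesis says that `1 - b` annihilates `Z * (1 + b * Z)`.
    have h0 : b * a * ((1 - b) * (Z * (1 + b * Z))) = 0 := by
      rw [sub_mul, one_mul, sub_eq_zero.2 h.symm, mul_zero]
    -- A free noncommutative identity; each term on the right contains one of the involution,
    -- commutation or braid relations, or the induction hypothesis.
    have e : (1 + b * Z) * (1 + a * (1 + b * Z)) - a * ((1 + b * Z) * (1 + a * (1 + b * Z)))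
        = (1 - a * a) + (1 - a * a) * (b * Z) + b * (Z * a - a * Z) * (1 + b * Z)
          - a * b * (Z * a - a * Z) * (1 + b * Z)
          - (a * b * a - b * a * b) * (Z * (1 + b * Z))
          + b * a * ((1 - b) * (Z * (1 + b * Z))) := by
      noncomm_ring
    rw [h0, ha', hb', hc] at e
    simp only [sub_self, zero_mul, mul_zero, add_zero] at e
    exact (sub_eq_zero.1 e).symm

include comm inv braid in
/-- The symmetrizer is invariant under its generating involutions. -/
theorem mul_braidSymmetrizer (m : ℕ) : ∀ j k, k ≤ j → j + 1 < k + m →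
    σ j * braidSymmetrizer σ m k = braidSymmetrizer σ m k := by
  induction m with
  | zero => intro j k _ _; omega
  | succ m ih =>
    intro j k hkj hj
    rw [braidSymmetrizer]
    -- For `j = k`, two chains are split off and `σ k` commutes past the remaining symmetrizer,
    -- which starts at `k + 2`. For `j > k`, the left factor is already invariant.
    rcases hkj.eq_or_lt with rfl | h
    · obtain ⟨m, rfl⟩ : ∃ m', m = m' + 1 := ⟨m - 1, by omega⟩
      rw [braidSymmetrizer, mul_assoc, ← mul_assoc (σ k),
        (commute_braidSymmetrizer comm m k (k + 1 + 1) le_rfl).eq, mul_assoc,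
        mul_braidChain_mul_braidChain comm inv braid]
    · rw [← mul_assoc, ih j (k + 1) h (by omega)]

end Symmetrizer

/-! ### Divided differences of triple sequences -/

namespace TripleSeq

variable {V W : Type*} [AddCommGroup V] [Module ℂ V] [AddCommGroup W] [Module ℂ W]

/-- Transposition of the first two arguments. -/
def S₁ : (ℕ → ℕ → ℕ → V) →ₗ[ℂ] (ℕ → ℕ → ℕ → V) where
  toFun f p q r := f q p r
  map_add' _ _ := rfl
  map_smul' _ _ := rfl

/-- Transposition of the last two arguments. -/
def S₂ : (ℕ → ℕ → ℕ → V) →ₗ[ℂ] (ℕ → ℕ → ℕ → V) where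
  toFun f p q r := f p r q
  map_add' _ _ := rfl
  map_smul' _ _ := rfl

/-- The divided difference in the first two arguments. -/
def D₁ : (ℕ → ℕ → ℕ → V) →ₗ[ℂ] (ℕ → ℕ → ℕ → V) where
  toFun f p q r := ∑ a ∈ Finset.range (min p q), (f (p + q - 1 - a) a r - f a (p + q - 1 - a) r)
  map_add' f g := by
    funext p q r
    simp only [Pi.add_apply, ← Finset.sum_add_distrib]
    exact Finset.sum_congr rfl fun _ _ => by abel
  map_smul' c f := by
    funext p q r
    simp [Finset.smul_sum, smul_sub]

/-- The divided difference in the last two arguments. -/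
def D₂ : (ℕ → ℕ → ℕ → V) →ₗ[ℂ] (ℕ → ℕ → ℕ → V) where
  toFun f p q r := ∑ a ∈ Finset.range (min q r), (f p (q + r - 1 - a) a - f p a (q + r - 1 - a))
  map_add' f g := by
    funext p q r
    simp only [Pi.add_apply, ← Finset.sum_add_distrib]
    exact Finset.sum_congr rfl fun _ _ => by abel
  map_smul' c f := by
    funext p q r
    simp [Finset.smul_sum, smul_sub]

theorem S₁_apply (f : ℕ → ℕ → ℕ → V) (p q r : ℕ) : S₁ f p q r = f q p r := rfl

theorem S₂_apply (f : ℕ → ℕ → ℕ → V) (p q r : ℕ) : S₂ f p q r = f p r q := rfl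

theorem D₁_apply (f : ℕ → ℕ → ℕ → V) (p q r : ℕ) : D₁ f p q r =
    ∑ a ∈ Finset.range (min p q), (f (p + q - 1 - a) a r - f a (p + q - 1 - a) r) := rfl

theorem D₂_apply (f : ℕ → ℕ → ℕ → V) (p q r : ℕ) : D₂ f p q r =
    ∑ a ∈ Finset.range (min q r), (f p (q + r - 1 - a) a - f p a (q + r - 1 - a)) := rfl

/-- Composition of a triple sequence with a linear map. -/
def comp (L : V →ₗ[ℂ] W) (f : ℕ → ℕ → ℕ → V) : ℕ → ℕ → ℕ → W := fun p q r => L (f p q r)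

theorem S₁_comp (L : V →ₗ[ℂ] W) (f : ℕ → ℕ → ℕ → V) : S₁ (comp L f) = comp L (S₁ f) := rfl

theorem S₂_comp (L : V →ₗ[ℂ] W) (f : ℕ → ℕ → ℕ → V) : S₂ (comp L f) = comp L (S₂ f) := rfl

theorem D₁_comp (L : V →ₗ[ℂ] W) (f : ℕ → ℕ → ℕ → V) : D₁ (comp L f) = comp L (D₁ f) := by
  funext p q r
  simp [comp, D₁_apply]

theorem D₂_comp (L : V →ₗ[ℂ] W) (f : ℕ → ℕ → ℕ → V) : D₂ (comp L f) = comp L (D₂ f) := by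
  funext p q r
  simp [comp, D₂_apply]

/-- Conjugation by permutations of the slots carries one divided difference to the other; this and
the next two lemmas are instances. -/
theorem S₁_S₂_D₁ (f : ℕ → ℕ → ℕ → V) : S₁ (S₂ (D₁ f)) = D₂ (S₁ (S₂ f)) := by
  funext p q r
  simp only [S₁_apply, S₂_apply, D₁_apply, D₂_apply]

theorem D₁_S₂_S₁ (f : ℕ → ℕ → ℕ → V) : D₁ (S₂ (S₁ f)) = S₂ (S₁ (D₂ f)) := by
  funext p q r
  simp only [S₁_apply, S₂_apply, D₁_apply, D₂_apply]

theorem S₁_D₂_S₁ (f : ℕ → ℕ → ℕ → V) : S₁ (D₂ (S₁ f)) = S₂ (D₁ (S₂ f)) := by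
  funext p q r
  simp only [S₁_apply, S₂_apply, D₁_apply, D₂_apply]

/-- The triple sequence `a ^ p * b ^ q * c ^ r`. -/
def char (a b c : ℂ) : ℕ → ℕ → ℕ → ℂ := fun p q r => a ^ p * b ^ q * c ^ r

/-- The universal triple sequence. -/
noncomputable def univ : ℕ → ℕ → ℕ → (ℕ × ℕ × ℕ →₀ ℂ) := fun p q r => Finsupp.single (p, q, r) 1

/-- The linear map that sends the universal triple sequence to `f`. -/
noncomputable def lin (f : ℕ → ℕ → ℕ → V) : (ℕ × ℕ × ℕ →₀ ℂ) →ₗ[ℂ] V :=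
  Finsupp.linearCombination ℂ fun t => f t.1 t.2.1 t.2.2

/-- Every sequence is a linear image of the universal one, and the operators commute with linear
maps, so operator identities need only be proved for `univ`. -/
theorem comp_lin_univ (f : ℕ → ℕ → ℕ → V) : comp (lin f) univ = f := by
  funext p q r
  simp [comp, lin, univ]

/-- Distinct exponents give distinct multiplicative characters of `ℂ × ℂ × ℂ`, which are linearly
independent by Dedekind's theorem. Hence characters separate finitely supported combinations. -/
theorem eq_of_lin_char {m m' : ℕ × ℕ × ℕ →₀ ℂ}
    (h : ∀ a b c, lin (char a b c) m = lin (char a b c) m') : m = m' := by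
  let φ : ℕ × ℕ × ℕ → (ℂ × ℂ × ℂ →* ℂ) := fun t =>
    { toFun := fun x => x.1 ^ t.1 * x.2.1 ^ t.2.1 * x.2.2 ^ t.2.2
      map_one' := by simp
      map_mul' := fun x y => by simp only [Prod.fst_mul, Prod.snd_mul, mul_pow]; ring }
  have hφ : Function.Injective φ := by
    rintro ⟨p, q, r⟩ ⟨p', q', r'⟩ e
    -- The exponents are recovered by evaluation at `(2, 1, 1)`, `(1, 2, 1)` and `(1, 1, 2)`.
    have h2 : Function.Injective fun k : ℕ => (2 : ℂ) ^ k := by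
      intro k l hkl
      have : ((2 ^ k : ℕ) : ℂ) = ((2 ^ l : ℕ) : ℂ) := by push_cast; exact hkl
      exact Nat.pow_right_injective le_rfl (Nat.cast_injective this)
    have e1 := h2 (by simpa [φ] using DFunLike.congr_fun e (2, 1, 1) : (2 : ℂ) ^ p = 2 ^ p')
    have e2 := h2 (by simpa [φ] using DFunLike.congr_fun e (1, 2, 1) : (2 : ℂ) ^ q = 2 ^ q')
    have e3 := h2 (by simpa [φ] using DFunLike.congr_fun e (1, 1, 2) : (2 : ℂ) ^ r = 2 ^ r')
    rw [e1, e2, e3]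
  have li := (linearIndependent_monoidHom (ℂ × ℂ × ℂ) ℂ).comp φ hφ
  apply li
  funext x
  have hx := h x.1 x.2.1 x.2.2
  simp only [lin, Finsupp.linearCombination_apply, Finsupp.sum, Finset.sum_apply] at hx ⊢
  exact hx

/-- For `p ≤ q` the two halves of the sum are `a ^ q` and `b ^ q` times one geometric sum, which `a
- b` multiplies to `a ^ p - b ^ p`. -/
theorem D_char_aux (a b : ℂ) (p q : ℕ) :
    (a - b) * ∑ i ∈ Finset.range (min p q), (a ^ (p + q - 1 - i) * b ^ i - a ^ i * b ^ (p + q - 1 - i))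
      = (a ^ p - b ^ p) * (a ^ q - b ^ q) := by
  have key : ∀ m k : ℕ, (a - b) * ∑ i ∈ Finset.range m,
      (a ^ (m + k + m - 1 - i) * b ^ i - a ^ i * b ^ (m + k + m - 1 - i))
      = (a ^ m - b ^ m) * (a ^ (m + k) - b ^ (m + k)) := by
    intro m k
    rw [Finset.sum_sub_distrib]
    have h1 : ∑ i ∈ Finset.range m, a ^ (m + k + m - 1 - i) * b ^ i
        = a ^ (m + k) * ∑ i ∈ Finset.range m, a ^ i * b ^ (m - 1 - i) := by
      rw [Finset.mul_sum, ← Finset.sum_range_reflect]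
      refine Finset.sum_congr rfl fun i hi => ?_
      rw [Finset.mem_range] at hi
      rw [← mul_assoc, ← pow_add]
      congr 2; omega
    have h2 : ∑ i ∈ Finset.range m, a ^ i * b ^ (m + k + m - 1 - i)
        = b ^ (m + k) * ∑ i ∈ Finset.range m, a ^ i * b ^ (m - 1 - i) := by
      rw [Finset.mul_sum]
      refine Finset.sum_congr rfl fun i hi => ?_
      rw [Finset.mem_range] at hi
      rw [mul_left_comm, ← pow_add]
      congr 2; omega
    rw [h1, h2]
    have h3 := (Commute.all a b).geom_sum₂_mul m
    linear_combination (a ^ (m + k) - b ^ (m + k)) * h3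
  rcases le_total p q with h | h
  · obtain ⟨k, rfl⟩ := Nat.exists_eq_add_of_le h
    rw [min_eq_left h, add_comm p (p + k)]
    exact key p k
  · obtain ⟨k, rfl⟩ := Nat.exists_eq_add_of_le h
    rw [min_eq_right h, mul_comm (a ^ (q + k) - _)]
    exact key q k

/-- When `a = b` every summand vanishes, in accordance with `0⁻¹ = 0`, so the formula holds without
exception. -/
theorem D_char_aux' (a b : ℂ) (p q : ℕ) :
    ∑ i ∈ Finset.range (min p q), (a ^ (p + q - 1 - i) * b ^ i - a ^ i * b ^ (p + q - 1 - i))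
      = (a - b)⁻¹ * ((a ^ p - b ^ p) * (a ^ q - b ^ q)) := by
  rcases eq_or_ne a b with rfl | h
  · rw [sub_self, inv_zero, zero_mul]
    refine Finset.sum_eq_zero fun i _ => ?_
    ring
  · rw [← D_char_aux, inv_mul_cancel_left₀ (sub_ne_zero.2 h)]

theorem D₁_char (a b c : ℂ) : D₁ (char a b c)
    = (a - b)⁻¹ • (char a a c + char b b c - char a b c - char b a c) := by
  funext p q r
  simp only [D₁_apply, char, Pi.smul_apply, Pi.sub_apply, Pi.add_apply, smul_eq_mul, ← sub_mul,
    ← Finset.sum_mul, D_char_aux']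
  ring

theorem D₂_char (a b c : ℂ) : D₂ (char a b c)
    = (b - c)⁻¹ • (char a b b + char a c c - char a b c - char a c b) := by
  funext p q r
  simp only [D₂_apply, char, Pi.smul_apply, Pi.sub_apply, Pi.add_apply, smul_eq_mul, mul_assoc,
    ← mul_sub, ← Finset.mul_sum, D_char_aux']
  ring

theorem S₁_char (a b c : ℂ) : S₁ (char a b c) = char b a c := by
  funext p q r
  simp only [S₁_apply, char]
  ring

theorem S₂_char (a b c : ℂ) : S₂ (char a b c) = char a c b := by
  funext p q r
  simp only [S₂_apply, char]
  ring

/-- Separates the coincidences among the three arguments, so that in each case the surviving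
denominators are nonzero. -/
theorem coincidence_cases {P : ℂ → ℂ → ℂ → Prop} (a b c : ℂ) (h₀ : ∀ a, P a a a)
    (h₁ : ∀ a b, a - b ≠ 0 → b - a ≠ 0 → P a a b ∧ P a b a ∧ P b a a)
    (h₂ : ∀ a b c, a - b ≠ 0 → b - a ≠ 0 → a - c ≠ 0 → c - a ≠ 0 → b - c ≠ 0 → c - b ≠ 0 →
      P a b c) : P a b c := by
  have hs : ∀ {a b : ℂ}, a ≠ b → a - b ≠ 0 ∧ b - a ≠ 0 := fun h =>
    ⟨sub_ne_zero.2 h, sub_ne_zero.2 h.symm⟩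
  rcases eq_or_ne a b with rfl | hab
  · rcases eq_or_ne a c with rfl | hac
    · exact h₀ a
    · exact (h₁ a c (hs hac).1 (hs hac).2).1
  · rcases eq_or_ne a c with rfl | hac
    · exact (h₁ a b (hs hab).1 (hs hab).2).2.1
    · rcases eq_or_ne b c with rfl | hbc
      · exact (h₁ b a (hs hab).2 (hs hab).1).2.2
      · exact h₂ a b c (hs hab).1 (hs hab).2 (hs hac).1 (hs hac).2 (hs hbc).1 (hs hbc).2

/-- Divided differences send characters to combinations of characters with rational coefficients, so
this is an identity of rational functions in `a`, `b`, `c` and their powers. -/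
theorem D₁_D₂_D₁_char (a b c : ℂ) :
    D₁ (D₂ (D₁ (char a b c))) = D₂ (D₁ (D₂ (char a b c))) := by
  funext p q r
  simp only [D₁_char, D₂_char, map_smul, map_add, map_sub, Pi.smul_apply, Pi.add_apply,
    Pi.sub_apply, smul_eq_mul]
  induction a, b, c using coincidence_cases with
  | h₀ a => simp
  | h₁ a b _ _ =>
    refine ⟨?_, ?_, ?_⟩ <;>
    · simp only [sub_self, inv_zero, zero_mul]
      field_simp
      ring
  | h₂ a b c _ _ _ _ _ _ =>
    simp only [sub_self, inv_zero, zero_mul]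
    field_simp
    ring

theorem D₁_D₂_D₁ (f : ℕ → ℕ → ℕ → V) : D₁ (D₂ (D₁ f)) = D₂ (D₁ (D₂ f)) := by
  have h : (D₁ (D₂ (D₁ univ)) : ℕ → ℕ → ℕ → (ℕ × ℕ × ℕ →₀ ℂ)) = D₂ (D₁ (D₂ univ)) := by
    funext p q r
    refine eq_of_lin_char fun a b c => ?_
    have e := congrFun (congrFun (congrFun (D₁_D₂_D₁_char a b c) p) q) r
    rw [← comp_lin_univ (char a b c)] at e
    simpa only [D₁_comp, D₂_comp, comp] using e
  rw [← comp_lin_univ f]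
  simp only [D₁_comp, D₂_comp, h]

theorem S₁_D₂_D₁_add_char (a b c : ℂ) :
    S₁ (D₂ (D₁ (char a b c))) + D₁ (D₂ (S₁ (char a b c))) = D₂ (S₁ (D₂ (char a b c))) := by
  funext p q r
  simp only [D₁_char, D₂_char, S₁_char, map_smul, map_add, map_sub, Pi.smul_apply, Pi.add_apply,
    Pi.sub_apply, smul_eq_mul]
  induction a, b, c using coincidence_cases with
  | h₀ a => simp
  | h₁ a b _ _ =>
    refine ⟨?_, ?_, ?_⟩ <;>
    · simp only [sub_self, inv_zero, zero_mul]
      field_simp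
      ring
  | h₂ a b c _ _ _ _ _ _ =>
    field_simp
    ring

/-- In the braid relation this is the part in which a single column transposition, that of the first
two slots, survives; `S₂_D₁_D₂_add` is its mirror image. -/
theorem S₁_D₂_D₁_add (f : ℕ → ℕ → ℕ → V) : S₁ (D₂ (D₁ f)) + D₁ (D₂ (S₁ f)) = D₂ (S₁ (D₂ f)) := by
  have h : (S₁ (D₂ (D₁ univ)) + D₁ (D₂ (S₁ univ)) : ℕ → ℕ → ℕ → (ℕ × ℕ × ℕ →₀ ℂ)) = D₂ (S₁ (D₂ univ)) := by
    funext p q r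
    refine eq_of_lin_char fun a b c => ?_
    have e := congrFun (congrFun (congrFun (S₁_D₂_D₁_add_char a b c) p) q) r
    rw [← comp_lin_univ (char a b c)] at e
    simpa only [D₁_comp, D₂_comp, S₁_comp, comp, map_add, Pi.add_apply] using e
  rw [← comp_lin_univ f]
  simp only [D₁_comp, D₂_comp, S₁_comp, ← h]
  funext p q r; simp [comp]

theorem S₂_D₁_D₂_add_char (a b c : ℂ) :
    S₂ (D₁ (D₂ (char a b c))) + D₂ (D₁ (S₂ (char a b c))) = D₁ (S₂ (D₁ (char a b c))) := by
  funext p q r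
  simp only [D₁_char, D₂_char, S₂_char, map_smul, map_add, map_sub, Pi.smul_apply, Pi.add_apply,
    Pi.sub_apply, smul_eq_mul]
  induction a, b, c using coincidence_cases with
  | h₀ a => simp
  | h₁ a b _ _ =>
    refine ⟨?_, ?_, ?_⟩ <;>
    · simp only [sub_self, inv_zero, zero_mul]
      field_simp
      ring
  | h₂ a b c _ _ _ _ _ _ =>
    field_simp
    ring

theorem S₂_D₁_D₂_add (f : ℕ → ℕ → ℕ → V) : S₂ (D₁ (D₂ f)) + D₂ (D₁ (S₂ f)) = D₁ (S₂ (D₁ f)) := by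
  have h : (S₂ (D₁ (D₂ univ)) + D₂ (D₁ (S₂ univ)) : ℕ → ℕ → ℕ → (ℕ × ℕ × ℕ →₀ ℂ)) = D₁ (S₂ (D₁ univ)) := by
    funext p q r
    refine eq_of_lin_char fun a b c => ?_
    have e := congrFun (congrFun (congrFun (S₂_D₁_D₂_add_char a b c) p) q) r
    rw [← comp_lin_univ (char a b c)] at e
    simpa only [D₁_comp, D₂_comp, S₂_comp, comp, map_add, Pi.add_apply] using e
  rw [← comp_lin_univ f]
  simp only [D₁_comp, D₂_comp, S₂_comp, ← h]
  funext p q r; simp [comp]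

end TripleSeq

/-! ### The braiding on sequences of matrix entries -/

namespace RTTBraid

open TripleSeq

variable {ι V : Type*} [AddCommGroup V] [Module ℂ V]

/-- The involution on functions of two generators `t_ij^(p)`, `t_kl^(q)` dual to the RTT
relation. -/
def pairOp : (ι × ι × ℕ → ι × ι × ℕ → V) →ₗ[ℂ] (ι × ι × ℕ → ι × ι × ℕ → V) where
  toFun g x y := g y x + ∑ a ∈ Finset.range (min x.2.2 y.2.2),
    (g (y.1, x.2.1, x.2.2 + y.2.2 - 1 - a) (x.1, y.2.1, a)
      - g (y.1, x.2.1, a) (x.1, y.2.1, x.2.2 + y.2.2 - 1 - a))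
  map_add' g h := by
    funext x y
    simp only [Pi.add_apply, add_sub_add_comm, Finset.sum_add_distrib]
    abel
  map_smul' c g := by
    funext x y
    simp [Finset.smul_sum, smul_sub]

theorem pairOp_apply (g : ι × ι × ℕ → ι × ι × ℕ → V) (x y : ι × ι × ℕ) :
    pairOp g x y = g y x + ∑ a ∈ Finset.range (min x.2.2 y.2.2),
      (g (y.1, x.2.1, x.2.2 + y.2.2 - 1 - a) (x.1, y.2.1, a)
        - g (y.1, x.2.1, a) (x.1, y.2.1, x.2.2 + y.2.2 - 1 - a)) := rfl

/-- The correction sum is antisymmetric under exchange of its two degrees. In the square, the nested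
sums thus cancel in pairs, and the single sums cancel term by term. -/
theorem pairOp_pairOp (g : ι × ι × ℕ → ι × ι × ℕ → V) : pairOp (pairOp g) = g := by
  funext x y
  obtain ⟨i, j, p⟩ := x
  obtain ⟨k, l, q⟩ := y
  simp only [pairOp_apply]
  rw [min_comm q p, add_assoc, ← Finset.sum_add_distrib]
  refine (add_eq_left.2 (Finset.sum_eq_zero fun a _ => ?_))
  rw [min_comm a, add_comm q p, add_comm a]
  abel

/-- `pairOp` on the first two of three arguments. -/
def op₁ (h : ι × ι × ℕ → ι × ι × ℕ → ι × ι × ℕ → V) :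
    ι × ι × ℕ → ι × ι × ℕ → ι × ι × ℕ → V :=
  fun x y z => pairOp (fun x y => h x y z) x y

/-- `pairOp` on the last two of three arguments. -/
def op₂ (h : ι × ι × ℕ → ι × ι × ℕ → ι × ι × ℕ → V) :
    ι × ι × ℕ → ι × ι × ℕ → ι × ι × ℕ → V :=
  fun x y z => pairOp (h x) y z

/-- The dependence on the degrees of a function of three generators. -/
def degrees (h : ι × ι × ℕ → ι × ι × ℕ → ι × ι × ℕ → V) (i j k i' j' k' : ι) :
    ℕ → ℕ → ℕ → V :=
  fun p q r => h (i, i', p) (j, j', q) (k, k', r)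

/-- Row indices are exchanged in both terms, column indices only in the term with `S₁`. With all
indices frozen, only operators on degrees remain. -/
theorem degrees_op₁ (h : ι × ι × ℕ → ι × ι × ℕ → ι × ι × ℕ → V) (i j k i' j' k' : ι) :
    degrees (op₁ h) i j k i' j' k'
      = S₁ (degrees h j i k j' i' k') + D₁ (degrees h j i k i' j' k') := rfl

theorem degrees_op₂ (h : ι × ι × ℕ → ι × ι × ℕ → ι × ι × ℕ → V) (i j k i' j' k' : ι) :
    degrees (op₂ h) i j k i' j' k'
      = S₂ (degrees h i k j i' k' j') + D₂ (degrees h i k j i' j' k') := rfl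

/-- Both sides permute the rows in the same way. Sorted by column permutation, the two expansions
agree by the conjugation rules, the braid relation for divided differences, and the two mixed
identities for a single transposition. -/
theorem op_braid (h : ι × ι × ℕ → ι × ι × ℕ → ι × ι × ℕ → V) :
    op₁ (op₂ (op₁ h)) = op₂ (op₁ (op₂ h)) := by
  funext x y z
  obtain ⟨i, i', p⟩ := x
  obtain ⟨j, j', q⟩ := y
  obtain ⟨k, k', r⟩ := z
  suffices e : degrees (op₁ (op₂ (op₁ h))) i j k i' j' k'
      = degrees (op₂ (op₁ (op₂ h))) i j k i' j' k' from
    congrFun (congrFun (congrFun e p) q) r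
  simp only [degrees_op₁, degrees_op₂, map_add, S₁_S₂_D₁, D₁_S₂_S₁, S₁_D₂_S₁, D₁_D₂_D₁,
    ← S₁_D₂_D₁_add, ← S₂_D₁_D₂_add]
  have e : ∀ f : ℕ → ℕ → ℕ → V, S₁ (S₂ (S₁ f)) = S₂ (S₁ (S₂ f)) := fun _ => rfl
  rw [e]
  abel

/-- Replacement of the entries of a sequence at `k` and `k + 1`. -/
def upd {X : Type*} (e : ℕ → X) (k : ℕ) (x y : X) : ℕ → X :=
  Function.update (Function.update e k x) (k + 1) y

section upd

variable {X : Type*} (e : ℕ → X) (k : ℕ)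

theorem upd_apply (x y : X) (m : ℕ) :
    upd e k x y m = if m = k + 1 then y else if m = k then x else e m := by
  simp [upd, Function.update_apply]

@[simp] theorem upd_fst (x y : X) : upd e k x y k = x := by simp [upd_apply]

@[simp] theorem upd_snd (x y : X) : upd e k x y (k + 1) = y := by simp [upd_apply]

@[simp] theorem upd_self : upd e k (e k) (e (k + 1)) = e := by
  funext m
  rw [upd_apply]
  split_ifs with h h' <;> simp_all

@[simp] theorem upd_upd (x y x' y' : X) : upd (upd e k x y) k x' y' = upd e k x' y' := by
  funext m
  simp only [upd_apply]
  split_ifs <;> rfl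

theorem upd_comm {j : ℕ} (h : j + 2 ≤ k) (x y x' y' : X) :
    upd (upd e k x y) j x' y' = upd (upd e j x' y') k x y := by
  funext m
  simp only [upd_apply]
  split_ifs <;> first | rfl | omega

end upd

/-- `pairOp` at the positions `k` and `k + 1` of a sequence. -/
def braidOp (k : ℕ) : ((ℕ → ι × ι × ℕ) → V) →ₗ[ℂ] ((ℕ → ι × ι × ℕ) → V) where
  toFun f e := pairOp (fun x y => f (upd e k x y)) (e k) (e (k + 1))
  map_add' f g := by
    funext e
    exact congrFun (congrFun (map_add pairOp _ _) _) _
  map_smul' c f := by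
    funext e
    exact congrFun (congrFun (map_smul pairOp c _) _) _

theorem braidOp_apply (k : ℕ) (f : (ℕ → ι × ι × ℕ) → V) (e : ℕ → ι × ι × ℕ) :
    braidOp k f e = pairOp (fun x y => f (upd e k x y)) (e k) (e (k + 1)) := rfl

theorem braidOp_upd (k : ℕ) (f : (ℕ → ι × ι × ℕ) → V) (e : ℕ → ι × ι × ℕ)
    (x y : ι × ι × ℕ) :
    braidOp k f (upd e k x y) = pairOp (fun x y => f (upd e k x y)) x y := by
  simp [braidOp_apply]

theorem braidOp_mul_self (k : ℕ) :
    (braidOp k * braidOp k : Module.End ℂ ((ℕ → ι × ι × ℕ) → V)) = 1 := by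
  ext f e
  simp only [Module.End.mul_apply, Module.End.one_apply]
  rw [braidOp_apply]
  simp only [braidOp_upd]
  rw [pairOp_pairOp, upd_self]

theorem pairOp_comm (g : ι × ι × ℕ → ι × ι × ℕ → ι × ι × ℕ → ι × ι × ℕ → V)
    (x y x' y' : ι × ι × ℕ) :
    pairOp (fun x y => pairOp (g x y) x' y') x y
      = pairOp (fun x' y' => pairOp (fun x y => g x y x' y') x y) x' y' := by
  simp only [pairOp_apply, Finset.sum_sub_distrib, Finset.sum_add_distrib]
  rw [Finset.sum_comm, Finset.sum_comm (s := Finset.range (min x.2.2 y.2.2)),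
    Finset.sum_comm (s := Finset.range (min x.2.2 y.2.2)),
    Finset.sum_comm (s := Finset.range (min x.2.2 y.2.2))]
  abel

theorem braidOp_comm {j k : ℕ} (h : j + 2 ≤ k) :
    (braidOp j * braidOp k : Module.End ℂ ((ℕ → ι × ι × ℕ) → V)) = braidOp k * braidOp j := by
  ext f e
  simp only [Module.End.mul_apply, braidOp_apply]
  have h1 : ∀ x y, upd e j x y k = e k := fun x y => by
    rw [upd_apply, if_neg (by omega), if_neg (by omega)]
  have h2 : ∀ x y, upd e j x y (k + 1) = e (k + 1) := fun x y => by
    rw [upd_apply, if_neg (by omega), if_neg (by omega)]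
  have h3 : ∀ x y, upd e k x y j = e j := fun x y => by
    rw [upd_apply, if_neg (by omega), if_neg (by omega)]
  have h4 : ∀ x y, upd e k x y (j + 1) = e (j + 1) := fun x y => by
    rw [upd_apply, if_neg (by omega), if_neg (by omega)]
  simp only [h1, h2, h3, h4]
  rw [pairOp_comm]
  simp only [upd_comm e k h]

/-- Replacement of the entries of a sequence at `k`, `k + 1` and `k + 2`. -/
def upd₃ {X : Type*} (e : ℕ → X) (k : ℕ) (x y z : X) : ℕ → X :=
  Function.update (upd e k x y) (k + 2) z

theorem upd₃_apply {X : Type*} (e : ℕ → X) (k : ℕ) (x y z : X) (m : ℕ) :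
    upd₃ e k x y z m
      = if m = k + 2 then z else if m = k + 1 then y else if m = k then x else e m := by
  simp [upd₃, Function.update_apply, upd_apply]

theorem braidOp_upd₃_fst (k : ℕ) (f : (ℕ → ι × ι × ℕ) → V) (e : ℕ → ι × ι × ℕ)
    (x y z : ι × ι × ℕ) :
    braidOp k f (upd₃ e k x y z) = op₁ (fun x y z => f (upd₃ e k x y z)) x y z := by
  have h : ∀ x' y', upd (upd₃ e k x y z) k x' y' = upd₃ e k x' y' z := fun x' y' => by
    funext m
    simp only [upd₃_apply, upd_apply]
    split_ifs <;> first | rfl | omega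
  simp [braidOp_apply, op₁, h, upd₃_apply]

theorem braidOp_upd₃_snd (k : ℕ) (f : (ℕ → ι × ι × ℕ) → V) (e : ℕ → ι × ι × ℕ)
    (x y z : ι × ι × ℕ) :
    braidOp (k + 1) f (upd₃ e k x y z) = op₂ (fun x y z => f (upd₃ e k x y z)) x y z := by
  have h : ∀ x' y', upd (upd₃ e k x y z) (k + 1) x' y' = upd₃ e k x x' y' := fun x' y' => by
    funext m
    simp only [upd₃_apply, upd_apply]
    split_ifs <;> rfl
  simp [braidOp_apply, op₂, h, upd₃_apply]

theorem braidOp_braid (k : ℕ) :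
    (braidOp k * braidOp (k + 1) * braidOp k : Module.End ℂ ((ℕ → ι × ι × ℕ) → V))
      = braidOp (k + 1) * braidOp k * braidOp (k + 1) := by
  ext f e
  -- Exhibiting the three affected entries turns the claim into `op_braid` for a function of three
  -- letters.
  have h : e = upd₃ e k (e k) (e (k + 1)) (e (k + 2)) := by
    funext m
    rw [upd₃_apply]
    split_ifs with h1 h2 h3 <;> simp_all
  simp only [Module.End.mul_apply]
  rw [h]
  simp only [braidOp_upd₃_fst, braidOp_upd₃_snd]
  exact congrFun (congrFun (congrFun (op_braid fun x y z => f (upd₃ e k x y z)) _) _) _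

end RTTBraid

/-! ### Symmetrized monomials and their leading terms. -/

namespace RTTBraid

open Finset in
theorem prod_range_upd {X R : Type*} [CommMonoid R] (g : X → R) (e : ℕ → X) {k m : ℕ}
    (hk : k + 1 < m) (x y : X) :
    ∏ i ∈ range m, g (upd e k x y i)
      = g x * g y * ∏ i ∈ ((range m).erase k).erase (k + 1), g (e i) := by
  rw [← mul_prod_erase (range m) _ (mem_range.2 (show k < m by omega)),
    ← mul_prod_erase ((range m).erase k) _
      (mem_erase.2 ⟨by omega, mem_range.2 hk⟩ : k + 1 ∈ (range m).erase k),
    upd_fst, upd_snd, mul_assoc]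
  congr 2
  refine prod_congr rfl fun i hi => ?_
  simp only [mem_erase] at hi
  rw [upd_apply, if_neg hi.1, if_neg hi.2.1]

section Symmetric

variable {ι R : Type*} [CommRing R] [Algebra ℂ R] (val : ι × ι × ℕ → R)

/-- The product of the values of the first `m` entries of a sequence. -/
def seqProd (m : ℕ) (e : ℕ → ι × ι × ℕ) : R := ∏ k ∈ Finset.range m, val (e k)

/-- The total degree of the first `m` entries of a sequence. -/
def seqDeg (m : ℕ) (e : ℕ → ι × ι × ℕ) : ℕ := ∑ k ∈ Finset.range m, (e k).2.2

omit [Algebra ℂ R] in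
theorem seqProd_upd {k m : ℕ} (hk : k + 1 < m) (e : ℕ → ι × ι × ℕ) (x y : ι × ι × ℕ) :
    seqProd val m (upd e k x y) = seqProd val m (upd e k y x) := by
  simp only [seqProd, prod_range_upd val e hk, mul_comm (val x)]

/-- Stated additively, since degrees are natural numbers and subtraction would truncate. -/
theorem seqDeg_upd {k m : ℕ} (hk : k + 1 < m) (e : ℕ → ι × ι × ℕ) (x y x' y' : ι × ι × ℕ) :
    seqDeg m (upd e k x y) + (x'.2.2 + y'.2.2) = seqDeg m (upd e k x' y') + (x.2.2 + y.2.2) := by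
  -- The product formula read in `Multiplicative ℕ` is the formula for the sum of the degrees.
  have h := fun x y => prod_range_upd (R := Multiplicative ℕ)
    (fun z : ι × ι × ℕ => Multiplicative.ofAdd z.2.2) e hk x y
  have h1 : seqDeg m (upd e k x y) = _ := h x y
  have h2 : seqDeg m (upd e k x' y') = _ := h x' y'
  rw [h1, h2]
  change (x.2.2 + y.2.2) + _ + (x'.2.2 + y'.2.2) = (x'.2.2 + y'.2.2) + _ + (x.2.2 + y.2.2)
  exact add_right_comm _ _ _ |>.trans (by rw [add_comm (x.2.2 + y.2.2) (x'.2.2 + y'.2.2)]) |>.trans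
    (add_right_comm _ _ _)

/-- The span of the commutative monomials of length `m` and degree less than `d`. -/
def seqLow (m d : ℕ) : Submodule ℂ R :=
  Submodule.span ℂ {x | ∃ e : ℕ → ι × ι × ℕ, seqDeg m e < d ∧ seqProd val m e = x}

theorem seqLow_mono (m : ℕ) : Monotone (seqLow val m) := fun _ _ h =>
  Submodule.span_mono fun _ ⟨e, he, hx⟩ => ⟨e, he.trans_le h, hx⟩

theorem seqProd_mem_seqLow {m d : ℕ} {e : ℕ → ι × ι × ℕ} (h : seqDeg m e < d) :
    seqProd val m e ∈ seqLow val m d :=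
  Submodule.subset_span ⟨e, h, rfl⟩

/-- The function `f` has leading term `c` times the commutative monomial of length `m`. -/
def HasLeading (m : ℕ) (c : ℂ) (f : (ℕ → ι × ι × ℕ) → R) : Prop :=
  ∀ e, f e - c • seqProd val m e ∈ seqLow val m (seqDeg m e)

variable {val}

theorem HasLeading.mem {m : ℕ} {c : ℂ} {f : (ℕ → ι × ι × ℕ) → R} (hf : HasLeading val m c f)
    {e : ℕ → ι × ι × ℕ} {d : ℕ} (h : seqDeg m e < d) : f e ∈ seqLow val m d := by
  have h1 := add_mem (seqLow_mono val m h.le (hf e))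
    (Submodule.smul_mem _ c (seqProd_mem_seqLow val h))
  rwa [sub_add_cancel] at h1

theorem HasLeading.add {m : ℕ} {c c' : ℂ} {f f' : (ℕ → ι × ι × ℕ) → R}
    (hf : HasLeading val m c f) (hf' : HasLeading val m c' f') :
    HasLeading val m (c + c') (f + f') := fun e => by
  have h := add_mem (hf e) (hf' e)
  rwa [← add_sub_add_comm, ← add_smul] at h

theorem HasLeading.smul {m : ℕ} {c : ℂ} {f : (ℕ → ι × ι × ℕ) → R}
    (hf : HasLeading val m c f) (b : ℂ) : HasLeading val m (b * c) (b • f) := fun e => by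
  have h := Submodule.smul_mem _ b (hf e)
  rwa [smul_sub, smul_smul] at h

/-- The transposition fixes the commutative monomial, and every correction term keeps the length and
lowers the total degree by one. -/
theorem HasLeading.braidOp {m k : ℕ} (hk : k + 1 < m) {c : ℂ} {f : (ℕ → ι × ι × ℕ) → R}
    (hf : HasLeading val m c f) : HasLeading val m c (braidOp k f) := fun e => by
  rw [braidOp_apply, pairOp_apply, add_sub_right_comm]
  have hd := seqDeg_upd hk e (e k) (e (k + 1))
  have hp := seqProd_upd val hk e (e k) (e (k + 1))
  simp only [upd_self] at hd hp
  refine add_mem ?_ (Submodule.sum_mem _ fun a ha => sub_mem (hf.mem ?_) (hf.mem ?_))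
  · have h := hf (upd e k (e (k + 1)) (e k))
    rw [hp]
    have h2 := hd (e (k + 1)) (e k)
    rwa [show seqDeg m (upd e k (e (k + 1)) (e k)) = seqDeg m e by omega] at h
  · have h2 := hd ((e (k + 1)).1, (e k).2.1, (e k).2.2 + (e (k + 1)).2.2 - 1 - a)
      ((e k).1, (e (k + 1)).2.1, a)
    rw [Finset.mem_range] at ha
    dsimp only at h2
    omega
  · have h2 := hd ((e (k + 1)).1, (e k).2.1, a)
      ((e k).1, (e (k + 1)).2.1, (e k).2.2 + (e (k + 1)).2.2 - 1 - a)
    rw [Finset.mem_range] at ha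
    dsimp only at h2
    omega

/-- The chain has `j + 1` terms and each preserves the leading coefficient; over all chains these
factors multiply to the factorial in the next lemma. -/
theorem HasLeading.braidChain {m : ℕ} {c : ℂ} {f : (ℕ → ι × ι × ℕ) → R}
    (hf : HasLeading val m c f) (j : ℕ) : ∀ k, k + j < m →
      HasLeading val m ((j + 1) * c) (braidChain RTTBraid.braidOp j k f) := by
  induction j with
  | zero => intro k _; simpa [_root_.braidChain] using hf
  | succ j ih =>
    intro k hk
    have h := hf.add ((ih (k + 1) (by omega)).braidOp (k := k) (by omega))
    have e : ((j + 1 : ℕ) + 1 : ℂ) * c = c + (j + 1) * c := by push_cast; ring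
    rw [e]
    exact h

theorem HasLeading.braidSymmetrizer {m : ℕ} {c : ℂ} (j : ℕ) : ∀ k, k + j ≤ m →
    ∀ {f : (ℕ → ι × ι × ℕ) → R}, HasLeading val m c f →
      HasLeading val m (j.factorial * c) (braidSymmetrizer RTTBraid.braidOp j k f) := by
  induction j generalizing c with
  | zero => intro k _ f hf; simpa [_root_.braidSymmetrizer] using hf
  | succ j ih =>
    intro k hk f hf
    have h := ih (k + 1) (by omega) (hf.braidChain j k (by omega))
    have e : ((j + 1).factorial : ℂ) * c = j.factorial * ((j + 1) * c) := by
      rw [Nat.factorial_succ]; push_cast; ring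
    rw [e]
    exact h

variable (val)

/-- The symmetrization of the commutative monomial of length `m`. -/
noncomputable def symProd (m : ℕ) : (ℕ → ι × ι × ℕ) → R :=
  (m.factorial : ℂ)⁻¹ • braidSymmetrizer braidOp m 0 (seqProd val m)

theorem braidOp_symProd {k m : ℕ} (hk : k + 1 < m) :
    braidOp k (symProd val m) = symProd val m := by
  have h := mul_braidSymmetrizer (σ := fun k => (braidOp k : Module.End ℂ ((ℕ → ι × ι × ℕ) → R)))
    (fun _ _ => braidOp_comm) braidOp_mul_self braidOp_braid m k 0 (Nat.zero_le k) (by omega)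
  rw [symProd, map_smul]
  exact congrArg _ (LinearMap.congr_fun h (seqProd val m))

theorem hasLeading_symProd (m : ℕ) : HasLeading val m 1 (symProd val m) := by
  have h : HasLeading val m 1 (seqProd val m) := fun e => by simp
  have h1 := (h.braidSymmetrizer m 0 (by omega)).smul (m.factorial : ℂ)⁻¹
  rwa [mul_one, inv_mul_cancel₀ (Nat.cast_ne_zero.2 m.factorial_ne_zero)] at h1

variable [Inhabited ι]

/-- The sequence that begins with a given word. -/
def pad (w : List (ι × ι × ℕ)) : ℕ → ι × ι × ℕ := fun k => w.getD k default

theorem upd_pad (u v : List (ι × ι × ℕ)) (x y x' y' : ι × ι × ℕ) :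
    upd (pad (u ++ x :: y :: v)) u.length x' y' = pad (u ++ x' :: y' :: v) := by
  funext m
  rw [upd_apply]
  simp only [pad]
  rcases lt_or_ge m u.length with h | h
  · rw [if_neg (by omega), if_neg (by omega), List.getD_append _ _ _ _ h,
      List.getD_append _ _ _ _ h]
  · obtain ⟨k, rfl⟩ := Nat.exists_eq_add_of_le h
    rw [List.getD_append_right _ _ _ _ h, List.getD_append_right _ _ _ _ h,
      Nat.add_sub_cancel_left]
    rcases k with _ | _ | k
    · simp
    · simp
    · rw [if_neg (by omega), if_neg (by omega)]
      simp

theorem pad_upd_self (u v : List (ι × ι × ℕ)) (x y : ι × ι × ℕ) :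
    pad (u ++ x :: y :: v) u.length = x ∧ pad (u ++ x :: y :: v) (u.length + 1) = y := by
  simp [pad]

theorem prod_range_pad {M : Type*} [CommMonoid M] (g : ι × ι × ℕ → M) (w : List (ι × ι × ℕ)) :
    ∏ k ∈ Finset.range w.length, g (pad w k) = (w.map g).prod := by
  induction w with
  | nil => simp
  | cons a w ih =>
    rw [List.length_cons, Finset.prod_range_succ', mul_comm, List.map_cons, List.prod_cons, ← ih]
    rfl

/-- The symmetrized commutative monomial of a word. -/
noncomputable def wordSym (w : List (ι × ι × ℕ)) : R := symProd val w.length (pad w)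

/-- `pairOp` does not alter the length of the word, so a single `symProd` is involved, and its
invariance at position `u.length` is the claim. -/
theorem wordSym_pairOp (u v : List (ι × ι × ℕ)) (x y : ι × ι × ℕ) :
    wordSym val (u ++ x :: y :: v)
      = pairOp (fun x y => wordSym val (u ++ x :: y :: v)) x y := by
  have hl : ∀ x y, (u ++ x :: y :: v).length = u.length + (v.length + 2) := fun x y => by simp
  simp only [wordSym, hl]
  conv_lhs => rw [← braidOp_symProd val (k := u.length) (by omega)]
  rw [braidOp_apply, (pad_upd_self u v x y).1, (pad_upd_self u v x y).2]
  simp only [upd_pad]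

theorem wordSym_sub_mem (w : List (ι × ι × ℕ)) :
    wordSym val w - (w.map val).prod
      ∈ seqLow val w.length (w.map fun x => x.2.2).sum := by
  have h := hasLeading_symProd val w.length (pad w)
  have h1 : seqProd val w.length (pad w) = _ := prod_range_pad val w
  have h2 : seqDeg w.length (pad w) = (w.map fun x => x.2.2).sum :=
    prod_range_pad (M := Multiplicative ℕ) (fun x => Multiplicative.ofAdd x.2.2) w
  rwa [h1, h2, one_smul] at h

end Symmetric

/-! ### The representation on functions of words -/

section Representation

variable (ι V : Type*) [AddCommGroup V] [Module ℂ V]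

/-- Functions of words that are compatible with the RTT relations. -/
def compatible : Submodule ℂ (List (ι × ι × ℕ) → V) where
  carrier := {h | ∀ u v x y, h (u ++ x :: y :: v) = pairOp (fun x y => h (u ++ x :: y :: v)) x y}
  add_mem' {f g} hf hg u v x y := by
    rw [Pi.add_apply, hf, hg]
    exact (congrFun (congrFun (map_add pairOp _ _) _) _).symm
  zero_mem' u v x y := (congrFun (congrFun (map_zero pairOp) _) _).symm
  smul_mem' c f hf u v x y := by
    rw [Pi.smul_apply, hf]
    exact (congrFun (congrFun (map_smul pairOp c _) _) _).symm

variable {ι V}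

/-- The action of a generator on compatible functions of words. -/
def act (x : ι × ι × ℕ) : Module.End ℂ (compatible ι V) where
  toFun h := ⟨fun w => h.1 (w ++ [x]), fun u v a b => by
    simpa using h.2 u (v ++ [x]) a b⟩
  map_add' _ _ := rfl
  map_smul' _ _ := rfl

theorem act_apply (x : ι × ι × ℕ) (h : compatible ι V) (w : List (ι × ι × ℕ)) :
    (act x h).1 w = h.1 (w ++ [x]) := rfl

/-- Appending `x` and then `y` puts them at the end of the word, where compatibility with empty
right part is the quadratic relation. -/
theorem act_mul_act (x y : ι × ι × ℕ) :
    (act x * act y : Module.End ℂ (compatible ι V)) = pairOp (fun x y => act x * act y) x y := by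
  ext h w
  have e := h.2 w [] x y
  simp only [Module.End.mul_apply, pairOp_apply, LinearMap.add_apply, LinearMap.sum_apply,
    LinearMap.sub_apply, Submodule.coe_add, Submodule.coe_sum, Submodule.coe_sub, Pi.add_apply,
    Finset.sum_apply, Pi.sub_apply, act_apply, List.append_assoc, List.cons_append,
    List.nil_append] at e ⊢
  exact e

end Representation

end RTTBraid

/-! ### The commutator formula for the generators. -/

namespace Yangian

open RTTBraid

/-- Telescoping of the sums that solve the RTT relations. -/
theorem sum_Ico_min_sub {A : Type*} [AddCommGroup A] (L : ℤ) (f : ℤ → ℤ → A)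
    (h₁ : ∀ a b, a < L → f a b = 0) (h₂ : ∀ a b, b < L → f a b = 0) (p q : ℤ) :
    ∑ a ∈ Finset.Ico L (min (p + 1) q), (f (p + 1 + q - 1 - a) a - f a (p + 1 + q - 1 - a))
      - ∑ a ∈ Finset.Ico L (min p (q + 1)), (f (p + (q + 1) - 1 - a) a - f a (p + (q + 1) - 1 - a))
      = f q p - f p q := by
  have e : p + (q + 1) - 1 = p + 1 + q - 1 := by ring
  rw [e]
  -- Below `L` the interval is empty and the extra term vanishes, so `m` needs no lower bound.
  have top : ∀ (m : ℤ) (g : ℤ → A), (m < L → g m = 0) →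
      ∑ a ∈ Finset.Ico L (m + 1), g a = ∑ a ∈ Finset.Ico L m, g a + g m := by
    intro m g hg
    rcases lt_or_ge m L with hm | hm
    · rw [hg hm, Finset.Ico_eq_empty (by omega), Finset.Ico_eq_empty (by omega), add_zero]
    · have hI : Finset.Ico L (m + 1) = insert m (Finset.Ico L m) := by
        ext x; simp only [Finset.mem_Ico, Finset.mem_insert]; omega
      rw [hI, Finset.sum_insert (by simp), add_comm]
  -- The two sums have the same summands: for `p < q` the first has the extra index `p`, for `q < p`
  -- the second has the extra index `q`, and for `p = q` they coincide.
  rcases lt_trichotomy p q with h | h | h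
  · rw [min_eq_left (show p + 1 ≤ q by omega), min_eq_left (show p ≤ q + 1 by omega), top p]
    · rw [show p + 1 + q - 1 - p = q by ring]; abel
    · intro hp; simp [h₁ _ _ hp, h₂ _ _ hp]
  · subst h
    rw [min_eq_right (show p ≤ p + 1 by omega), min_eq_left (show p ≤ p + 1 by omega)]
    abel
  · rw [min_eq_right (show q ≤ p + 1 by omega), min_eq_right (show q + 1 ≤ p by omega), top q]
    · rw [show p + 1 + q - 1 - q = p by ring]; abel
    · intro hq; simp [h₁ _ _ hq, h₂ _ _ hq]

/-- The commutator of two generators. -/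
theorem t_mul_t (n N : ℕ) (i j k l : Fin n) (p q : ℤ) :
    t n N i j p * t n N k l q = t n N k l q * t n N i j p
      + ∑ a ∈ Finset.Ico (-(N : ℤ)) (min p q),
        (t n N k j (p + q - 1 - a) * t n N i l a - t n N k j a * t n N i l (p + q - 1 - a)) := by
  rcases lt_or_ge p (-(N : ℤ)) with hp | hp
  · rw [t_eq_zero n N i j hp, Finset.Ico_eq_empty (by omega)]
    simp
  -- The induction starts one step below `-N`, where both sides are zero. The relation moves one
  -- unit of degree from the second generator to the first, so `q` must stay general.
  have key : ∀ p : ℤ, -(N : ℤ) - 1 ≤ p → ∀ q : ℤ,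
      t n N i j p * t n N k l q - t n N k l q * t n N i j p
        = ∑ a ∈ Finset.Ico (-(N : ℤ)) (min p q),
          (t n N k j (p + q - 1 - a) * t n N i l a - t n N k j a * t n N i l (p + q - 1 - a)) := by
    intro p hp
    induction p, hp using Int.leInduction with
    | base =>
      intro q
      rw [t_eq_zero n N i j (show -(N : ℤ) - 1 < -(N : ℤ) by omega),
        Finset.Ico_eq_empty (by omega)]
      simp
    | succ p hp ih =>
      intro q
      rw [sub_eq_iff_eq_add.1 (t_rel n N i j k l p q), ih (q + 1),
        ← sum_Ico_min_sub (-(N : ℤ)) (fun a b => t n N k j a * t n N i l b)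
          (fun a b h => by rw [t_eq_zero n N k j h, zero_mul])
          (fun a b h => by rw [t_eq_zero n N i l h, mul_zero]) p q, sub_add_cancel]
  rw [← key p (by omega) q]
  abel

/-! ### The symmetrization map -/

/-- The letter `(i, j, r + N)` attached to the generator `t_ij^(r)`. -/
def site {n : ℕ} (N : ℕ) (i j : Fin n) (r : ℤ) : ℕ × ℕ × ℕ := (i, j, (r + N).toNat)

/-- The action of `t_ij^(r)` on compatible functions of words. -/
noncomputable def tAct (n N : ℕ) (i j : Fin n) (r : ℤ) :
    Module.End ℂ (compatible ℕ (OMat n N)) :=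
  if -(N : ℤ) ≤ r then act (site N i j r) else 0

theorem tAct_of_le (n N : ℕ) (i j : Fin n) {r : ℤ} (h : -(N : ℤ) ≤ r) :
    tAct n N i j r = act (site N i j r) := if_pos h

theorem tAct_of_lt (n N : ℕ) (i j : Fin n) {r : ℤ} (h : r < -(N : ℤ)) :
    tAct n N i j r = 0 := if_neg (not_le.2 h)

theorem tAct_mul_tAct (n N : ℕ) (i j k l : Fin n) (p q : ℤ) :
    tAct n N i j p * tAct n N k l q = tAct n N k l q * tAct n N i j p
      + ∑ a ∈ Finset.Ico (-(N : ℤ)) (min p q), (tAct n N k j (p + q - 1 - a) * tAct n N i l a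
        - tAct n N k j a * tAct n N i l (p + q - 1 - a)) := by
  rcases lt_or_ge p (-(N : ℤ)) with hp | hp
  · rw [tAct_of_lt n N i j hp, Finset.Ico_eq_empty (by omega)]
    simp
  rcases lt_or_ge q (-(N : ℤ)) with hq | hq
  · rw [tAct_of_lt n N k l hq, Finset.Ico_eq_empty (by omega)]
    simp
  obtain ⟨P, rfl⟩ : ∃ P : ℕ, p = P - N := ⟨(p + N).toNat, by omega⟩
  obtain ⟨Q, rfl⟩ : ∃ Q : ℕ, q = Q - N := ⟨(q + N).toNat, by omega⟩
  rw [tAct_of_le n N i j hp, tAct_of_le n N k l hq, act_mul_act, pairOp_apply]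
  have e : ∀ (i j : Fin n) (r : ℕ), site N i j ((r : ℤ) - N) = ((i : ℕ), (j : ℕ), r) :=
    fun i j r => by simp [site]
  rw [e, e]
  congr 1
  have hI : Finset.Ico (-(N : ℤ)) (min ((P : ℤ) - N) (Q - N))
      = (Finset.range (min P Q)).image fun a : ℕ => (a : ℤ) - N := by
    ext x
    simp only [Finset.mem_Ico, Finset.mem_image, Finset.mem_range]
    constructor
    · intro h; exact ⟨(x + N).toNat, by omega, by omega⟩
    · rintro ⟨a, ha, rfl⟩; omega
  rw [hI, Finset.sum_image (fun a _ b _ h => by simpa using h)]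
  refine Finset.sum_congr rfl fun a ha => ?_
  rw [Finset.mem_range] at ha
  -- The natural subtraction is not truncated, because `a < min P Q`.
  have h1 : (P : ℤ) - N + (Q - N) - 1 - (a - N) = ((P + Q - 1 - a : ℕ) : ℤ) - N := by omega
  rw [h1, tAct_of_le n N _ _ (by omega), tAct_of_le n N _ _ (by omega),
    tAct_of_le n N _ _ (by omega), tAct_of_le n N _ _ (by omega), e, e, e, e]

/-- The representation of `Y^rtt(gl_n)^pol` on compatible functions of words. -/
noncomputable def polRep (n N : ℕ) :
    YPol n →ₐ[ℂ] Module.End ℂ (compatible ℕ (OMat n N)) :=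
  RingQuot.liftAlgHom ℂ ⟨FreeAlgebra.lift ℂ fun a => tAct n N a.1 a.2.1 a.2.2, by
    rintro _ _ ⟨i, j, k, l, p, q⟩
    simp only [map_sub, map_mul, FreeAlgebra.lift_ι_apply]
    have h₁ := sub_eq_of_eq_add' (G := Module.End ℂ (compatible ℕ (OMat n N)))
      (tAct_mul_tAct n N i j k l (p + 1) q)
    have h₂ := sub_eq_of_eq_add' (G := Module.End ℂ (compatible ℕ (OMat n N)))
      (tAct_mul_tAct n N i j k l p (q + 1))
    rw [h₁, h₂]
    exact sum_Ico_min_sub (-(N : ℤ)) (fun a b => tAct n N k j a * tAct n N i l b)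
      (fun a b h => by rw [tAct_of_lt n N k j h, zero_mul])
      (fun a b h => by rw [tAct_of_lt n N i l h, mul_zero]) p q⟩

theorem polRep_tPol (n N : ℕ) (i j : Fin n) (r : ℤ) :
    polRep n N (tPol n i j r) = tAct n N i j r := by
  refine (RingQuot.liftAlgHom_mkAlgHom_apply ℂ _ _ _).trans ?_
  simp

/-- The representation of `Y^rtt(gl_n)_N` on compatible functions of words. -/
noncomputable def rep (n N : ℕ) : Y n N →ₐ[ℂ] Module.End ℂ (compatible ℕ (OMat n N)) :=
  RingQuot.liftAlgHom ℂ ⟨polRep n N, by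
    rintro _ _ ⟨i, j, r, hr⟩
    rw [map_zero, polRep_tPol, tAct_of_lt n N i j (by omega)]⟩

theorem rep_t (n N : ℕ) (i j : Fin n) (r : ℤ) : rep n N (t n N i j r) = tAct n N i j r :=
  (RingQuot.liftAlgHom_mkAlgHom_apply ℂ _ _ _).trans (polRep_tPol n N i j r)

/-- The function `Δ_ij^(p - N)` attached to a letter `(i, j, p)`. -/
noncomputable def siteVal (n N : ℕ) (x : ℕ × ℕ × ℕ) : OMat n N :=
  if h : x.1 < n ∧ x.2.1 < n then Δ n N ⟨x.1, h.1⟩ ⟨x.2.1, h.2⟩ (x.2.2 - N) else 0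

/-- Letters carry natural numbers instead of elements of `Fin n` because padding needs a default
index, which `Fin 0` lacks; the value chosen outside the range plays no role for actual generators.
-/
theorem siteVal_site (n N : ℕ) (i j : Fin n) {r : ℤ} (h : -(N : ℤ) ≤ r) :
    siteVal n N (site N i j r) = Δ n N i j r := by
  rw [siteVal, dif_pos ⟨i.2, j.2⟩]
  congr 1
  simp only [site]
  omega

/-- The symmetrized monomials as a compatible function of words. -/
noncomputable def symFun (n N : ℕ) : compatible ℕ (OMat n N) :=
  ⟨wordSym (siteVal n N), fun u v x y => wordSym_pairOp _ u v x y⟩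

/-- The symmetrization map from `Y^rtt(gl_n)_N` to functions on `z^N Mat_n[[z⁻¹]]`. -/
noncomputable def symMap (n N : ℕ) : Y n N →ₗ[ℂ] OMat n N where
  toFun y := (rep n N y (symFun n N)).1 []
  map_add' x y := by simp
  map_smul' c x := by simp

/-- The degree of a monomial in the functions `Δ_ij^(r)`. -/
def wt {n N : ℕ} (g : Gen n N) : ℤ := g.r

/-- Functions all of whose monomials have degree less than `d`. -/
def lowDeg (n N : ℕ) (d : ℤ) : Submodule ℂ (OMat n N) where
  carrier := {f | ∀ m, d ≤ Finsupp.weight wt m → f.coeff m = 0}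
  add_mem' hf hg m hm := by rw [MvPolynomial.coeff_add, hf m hm, hg m hm, add_zero]
  zero_mem' m _ := MvPolynomial.coeff_zero m
  smul_mem' c f hf m hm := by rw [MvPolynomial.coeff_smul, hf m hm, smul_zero]

theorem lowDeg_mono (n N : ℕ) : Monotone (lowDeg n N) := fun _ _ h _ hf m hm => hf m (h.trans hm)

theorem isWeightedHomogeneous_Δ (n N : ℕ) (i j : Fin n) (r : ℤ) :
    MvPolynomial.IsWeightedHomogeneous (wt (n := n) (N := N)) (Δ n N i j r) r := by
  unfold Δ
  split_ifs with h
  · exact MvPolynomial.isWeightedHomogeneous_X ℂ wt (⟨i, j, r, h⟩ : Gen n N)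
  · exact MvPolynomial.isWeightedHomogeneous_zero ℂ wt r

theorem isWeightedHomogeneous_siteVal (n N : ℕ) (x : ℕ × ℕ × ℕ) :
    MvPolynomial.IsWeightedHomogeneous (wt (n := n) (N := N)) (siteVal n N x) (x.2.2 - N) := by
  unfold siteVal
  split_ifs with h
  · exact isWeightedHomogeneous_Δ n N _ _ _
  · exact MvPolynomial.isWeightedHomogeneous_zero ℂ wt _

theorem mem_lowDeg_of_isWeightedHomogeneous {n N : ℕ} {f : OMat n N} {e d : ℤ}
    (hf : MvPolynomial.IsWeightedHomogeneous wt f e) (h : e < d) : f ∈ lowDeg n N d :=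
  fun m hm => hf.coeff_eq_zero m (by omega)

/-- Letters have degree `r + N`, so at fixed length `m` the two gradings differ by the constant `N *
m`. This is why the correction terms must have the same length. -/
theorem seqLow_le_lowDeg (n N m d : ℕ) :
    seqLow (siteVal n N) m d ≤ lowDeg n N ((d : ℤ) - N * m) := by
  refine Submodule.span_le.2 ?_
  rintro _ ⟨e, he, rfl⟩
  refine mem_lowDeg_of_isWeightedHomogeneous (MvPolynomial.IsWeightedHomogeneous.prod
    (Finset.range m) (fun k => siteVal n N (e k)) (fun k => ((e k).2.2 : ℤ) - N)
    (fun k _ => isWeightedHomogeneous_siteVal n N (e k))) ?_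
  rw [Finset.sum_sub_distrib, Finset.sum_const, Finset.card_range, nsmul_eq_mul, mul_comm (m : ℤ)]
  have h : ((∑ k ∈ Finset.range m, (e k).2.2 : ℕ) : ℤ) < d := by exact_mod_cast he
  push_cast at h
  omega

/-- The letter of a generator. -/
def Gen.letter {n N : ℕ} (g : Gen n N) : Letter n := (g.i, g.j, g.r)

theorem rep_word (n N : ℕ) (w : List (Gen n N)) (h : compatible ℕ (OMat n N))
    (u : List (ℕ × ℕ × ℕ)) :
    (rep n N (word n N (w.map Gen.letter)) h).1 u = h.1 (u ++ w.map fun g => site N g.i g.j g.r) := by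
  induction w generalizing u with
  | nil => simp [word]
  | cons g w ih =>
    have e : word n N ((g :: w).map Gen.letter)
        = t n N g.i g.j g.r * word n N (w.map Gen.letter) := by
      simp [word, Gen.letter]
    rw [e, map_mul, Module.End.mul_apply, rep_t, tAct_of_le n N _ _ g.hr, act_apply, ih]
    simp

/-- The leading term of the symmetrization of a word is its commutative monomial. -/
theorem symMap_word_sub_mem (n N : ℕ) (w : List (Gen n N)) :
    symMap n N (word n N (w.map Gen.letter)) - (w.map MvPolynomial.X).prod
      ∈ lowDeg n N (wordDeg (w.map Gen.letter)) := by
  have h := seqLow_le_lowDeg n N _ _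
    (wordSym_sub_mem (siteVal n N) (w.map fun g => site N g.i g.j g.r))
  have h1 : symMap n N (word n N (w.map Gen.letter))
      = wordSym (siteVal n N) (w.map fun g => site N g.i g.j g.r) := by
    exact rep_word n N w (symFun n N) []
  have h2 : ((w.map fun g => site N g.i g.j g.r).map (siteVal n N))
      = (w.map MvPolynomial.X : List (OMat n N)) := by
    rw [List.map_map]
    refine List.map_congr_left fun g _ => ?_
    rw [Function.comp_apply, siteVal_site n N _ _ g.hr, Δ_gen]
  have h3 : ((((w.map fun g => site N g.i g.j g.r).map fun x => x.2.2).sum : ℕ) : ℤ)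
      - N * ((w.map fun g => site N g.i g.j g.r).length : ℕ) = wordDeg (w.map Gen.letter) := by
    clear h h1 h2
    induction w with
    | nil => simp [wordDeg]
    | cons g w ih =>
      have hg := g.hr
      have e : wordDeg ((g :: w).map Gen.letter) = g.r + wordDeg (w.map Gen.letter) := by
        simp [wordDeg, Gen.letter]
      rw [e, ← ih]
      simp only [List.map_cons, List.sum_cons, List.length_cons, site]
      push_cast
      rw [Int.toNat_of_nonneg (by omega)]
      ring
  rwa [h1, ← h2, ← h3]

end Yangian

namespace Yangian

variable {n N : ℕ}

/-! ### Ordered monomials span -/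

theorem word_cons_letter (g : Gen n N) (w : List (Gen n N)) :
    word n N ((g :: w).map Gen.letter) = t n N g.i g.j g.r * word n N (w.map Gen.letter) := by
  simp [word, Gen.letter]

theorem wordDeg_cons_letter (g : Gen n N) (w : List (Gen n N)) :
    wordDeg ((g :: w).map Gen.letter) = g.r + wordDeg (w.map Gen.letter) := by
  simp [wordDeg, Gen.letter]

theorem le_wordDeg (w : List (Gen n N)) : -(N * w.length : ℤ) ≤ wordDeg (w.map Gen.letter) := by
  induction w with
  | nil => simp [wordDeg]
  | cons g w ih =>
    have h := g.hr
    rw [wordDeg_cons_letter, List.length_cons]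
    push_cast
    linarith

theorem wordDeg_perm {w w' : List (Gen n N)} (h : w.Perm w') :
    wordDeg (w.map Gen.letter) = wordDeg (w'.map Gen.letter) :=
  ((h.map _).map _).sum_eq

/-- The span of the words of length `m` and degree at most `d`. -/
def wordSpan (n N m : ℕ) (d : ℤ) : Submodule ℂ (Y n N) :=
  Submodule.span ℂ {x | ∃ w : List (Gen n N), w.length = m ∧ wordDeg (w.map Gen.letter) ≤ d ∧
    word n N (w.map Gen.letter) = x}

theorem word_mem_wordSpan {w : List (Gen n N)} {m : ℕ} {d : ℤ} (hm : w.length = m)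
    (hd : wordDeg (w.map Gen.letter) ≤ d) : word n N (w.map Gen.letter) ∈ wordSpan n N m d :=
  Submodule.subset_span ⟨w, hm, hd, rfl⟩

theorem t_mul_mem_wordSpan (g : Gen n N) {m : ℕ} {d : ℤ} {x : Y n N}
    (hx : x ∈ wordSpan n N m d) : t n N g.i g.j g.r * x ∈ wordSpan n N (m + 1) (g.r + d) := by
  induction hx using Submodule.span_induction with
  | zero => simp
  | add x y _ _ hx hy => rw [mul_add]; exact add_mem hx hy
  | smul c x _ hx => rw [mul_smul_comm]; exact Submodule.smul_mem _ _ hx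
  | mem x hx =>
    obtain ⟨w, hm, hd, rfl⟩ := hx
    rw [← word_cons_letter]
    exact word_mem_wordSpan (by simp [hm]) (by rw [wordDeg_cons_letter]; omega)

/-- A swap of neighbours is the commutator formula, whose correction words keep the length and lose
one degree; general permutations follow by telescoping. -/
theorem word_sub_word_mem_of_perm {w w' : List (Gen n N)} (h : w.Perm w') :
    word n N (w.map Gen.letter) - word n N (w'.map Gen.letter)
      ∈ wordSpan n N w.length (wordDeg (w.map Gen.letter) - 1) := by
  induction h with
  | nil => simp
  | cons g _ ih =>
    rw [word_cons_letter, word_cons_letter, wordDeg_cons_letter, ← mul_sub, add_sub_assoc]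
    exact t_mul_mem_wordSpan g ih
  | swap g g' w =>
    simp only [word_cons_letter, wordDeg_cons_letter, ← mul_assoc]
    rw [t_mul_t, add_mul, add_sub_cancel_left, Finset.sum_mul]
    refine Submodule.sum_mem _ fun a ha => ?_
    rw [Finset.mem_Ico, lt_min_iff] at ha
    have h := g.hr
    have h' := g'.hr
    have key : ∀ (i j k l : Fin n) (p q : ℤ), -(N : ℤ) ≤ p → -(N : ℤ) ≤ q →
        p + q = g'.r + g.r - 1 → t n N i j p * t n N k l q * word n N (w.map Gen.letter)
          ∈ wordSpan n N (g' :: g :: w).length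
            (g'.r + (g.r + wordDeg (w.map Gen.letter)) - 1) := by
      intro i j k l p q hp hq hpq
      have e : t n N i j p * t n N k l q * word n N (w.map Gen.letter)
          = word n N (((⟨i, j, p, hp⟩ : Gen n N) :: ⟨k, l, q, hq⟩ :: w).map Gen.letter) := by
        simp only [word_cons_letter, mul_assoc]
      rw [e]
      refine word_mem_wordSpan (by simp) ?_
      simp only [wordDeg_cons_letter]
      omega
    rw [sub_mul]
    exact sub_mem (key _ _ _ _ _ _ (by omega) (by omega) (by ring))
      (key _ _ _ _ _ _ (by omega) (by omega) (by ring))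
  | trans h₁ _ ih₁ ih₂ =>
    rw [← wordDeg_perm h₁, ← h₁.length_eq] at ih₂
    have h := add_mem ih₁ ih₂
    rwa [sub_add_sub_cancel] at h

theorem orderedMonomial_eq_word [LinearOrder (Gen n N)] (s : Multiset (Gen n N)) :
    orderedMonomial s = word n N ((s.sort (· ≤ ·)).map Gen.letter) := by
  simp [orderedMonomial, word, Gen.letter, Function.comp_def]

theorem word_mem_span_orderedMonomial [LinearOrder (Gen n N)] (w : List (Gen n N)) :
    word n N (w.map Gen.letter) ∈ Submodule.span ℂ (Set.range (orderedMonomial (n := n) (N := N))) := by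
  -- The shifted degree `wordDeg + N * length` is nonnegative and drops in every correction word, so
  -- induction on a strict bound for it terminates.
  obtain ⟨k, hk⟩ : ∃ k : ℕ, wordDeg (w.map Gen.letter) + N * w.length < k :=
    ⟨(wordDeg (w.map Gen.letter) + N * w.length + 1).toNat, by omega⟩
  induction k generalizing w with
  | zero =>
    have h := le_wordDeg w
    push_cast at hk
    omega
  | succ k ih =>
    have hp : w.Perm ((w : Multiset (Gen n N)).sort (· ≤ ·)) := by
      rw [← Multiset.coe_eq_coe, Multiset.sort_eq]
    have h := word_sub_word_mem_of_perm hp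
    rw [← orderedMonomial_eq_word] at h
    have hle : wordSpan n N w.length (wordDeg (w.map Gen.letter) - 1)
        ≤ Submodule.span ℂ (Set.range (orderedMonomial (n := n) (N := N))) := by
      refine Submodule.span_le.2 ?_
      rintro _ ⟨v, hm, hd, rfl⟩
      refine ih v ?_
      rw [hm]
      push_cast at hk
      omega
    have h2 := add_mem (hle h) (Submodule.subset_span ⟨(w : Multiset (Gen n N)), rfl⟩)
    rwa [sub_add_cancel] at h2

theorem word_eq_zero_or (w : List (Letter n)) :
    word n N w = 0 ∨ ∃ v : List (Gen n N), v.map Gen.letter = w := by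
  induction w with
  | nil => exact Or.inr ⟨[], rfl⟩
  | cons a w ih =>
    have e : word n N (a :: w) = t n N a.1 a.2.1 a.2.2 * word n N w := by simp [word]
    rcases ih with h | ⟨v, rfl⟩
    · left; rw [e, h, mul_zero]
    · rcases lt_or_ge a.2.2 (-(N : ℤ)) with ha | ha
      · left; rw [e, t_eq_zero n N _ _ ha, zero_mul]
      · exact Or.inr ⟨⟨a.1, a.2.1, a.2.2, ha⟩ :: v, rfl⟩

theorem span_word : Submodule.span ℂ (Set.range (word n N)) = ⊤ := by
  have hone : (1 : Y n N) ∈ Submodule.span ℂ (Set.range (word n N)) :=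
    Submodule.subset_span ⟨[], rfl⟩
  obtain ⟨φ, hφ, hι⟩ : ∃ φ : FreeAlgebra ℂ (Letter n) →ₐ[ℂ] Y n N, Function.Surjective φ ∧
      ∀ a, φ (FreeAlgebra.ι ℂ a) = t n N a.1 a.2.1 a.2.2 :=
    ⟨(proj n N).comp (RingQuot.mkAlgHom ℂ (PolRel n)),
      (RingQuot.mkAlgHom_surjective ℂ (TruncRel n N)).comp
        (RingQuot.mkAlgHom_surjective ℂ (PolRel n)), fun _ => rfl⟩
  refine eq_top_iff.2 fun y _ => ?_
  obtain ⟨y, rfl⟩ := hφ y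
  induction y using FreeAlgebra.induction with
  | grade0 c =>
    rw [AlgHom.commutes, Algebra.algebraMap_eq_smul_one]
    exact Submodule.smul_mem _ _ hone
  | grade1 a => exact Submodule.subset_span ⟨[a], by simp [word, hι]⟩
  | add x y hx hy => rw [map_add]; exact add_mem (hx trivial) (hy trivial)
  | mul x y hx hy =>
    rw [map_mul]
    have h := Submodule.mul_mem_mul (hx trivial) (hy trivial)
    rw [Submodule.span_mul_span] at h
    refine Submodule.span_mono ?_ h
    rintro _ ⟨_, ⟨u, rfl⟩, _, ⟨v, rfl⟩, rfl⟩
    exact ⟨u ++ v, by simp [word]⟩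

theorem span_orderedMonomial [LinearOrder (Gen n N)] :
    Submodule.span ℂ (Set.range (orderedMonomial (n := n) (N := N))) = ⊤ := by
  rw [eq_top_iff, ← span_word, Submodule.span_le]
  rintro _ ⟨w, rfl⟩
  rcases word_eq_zero_or (N := N) w with h | ⟨v, rfl⟩
  · rw [h]; exact zero_mem _
  · exact word_mem_span_orderedMonomial v

/-! ### Ordered monomials are linearly independent -/

theorem prod_map_X [DecidableEq (Gen n N)] (s : Multiset (Gen n N)) :
    (s.map MvPolynomial.X).prod = MvPolynomial.monomial (R := ℂ) (Multiset.toFinsupp s) 1 := by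
  induction s using Multiset.induction with
  | empty => simp
  | cons a s ih =>
    rw [Multiset.map_cons, Multiset.prod_cons, ih, ← Multiset.singleton_add, map_add,
      Multiset.toFinsupp_singleton, MvPolynomial.X, MvPolynomial.monomial_mul, one_mul]

theorem isWeightedHomogeneous_prod_X (w : List (Gen n N)) :
    MvPolynomial.IsWeightedHomogeneous wt (w.map MvPolynomial.X : List (OMat n N)).prod
      (wordDeg (w.map Gen.letter)) := by
  induction w with
  | nil => exact MvPolynomial.isWeightedHomogeneous_one ℂ wt
  | cons g w ih =>
    rw [wordDeg_cons_letter, List.map_cons, List.prod_cons]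
    exact (MvPolynomial.isWeightedHomogeneous_X ℂ wt g).mul ih

theorem linearIndependent_orderedMonomial [LinearOrder (Gen n N)] :
    LinearIndependent ℂ (orderedMonomial (n := n) (N := N)) := by
  classical
  rw [linearIndependent_iff]
  intro l hl
  by_contra hne
  let deg : Multiset (Gen n N) → ℤ := fun s => wordDeg ((s.sort (· ≤ ·)).map Gen.letter)
  -- At the exponent of a monomial of maximal degree, lower-order terms contribute nothing, so
  -- applying `symMap` to the relation isolates the coefficient of `s₀`.
  obtain ⟨s₀, hs₀, hmax⟩ := Finset.exists_max_image l.support deg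
    (Finsupp.support_nonempty_iff.2 hne)
  have hmon : ∀ s : Multiset (Gen n N),
      ((s.sort (· ≤ ·)).map MvPolynomial.X : List (OMat n N)).prod
        = MvPolynomial.monomial (Multiset.toFinsupp s) 1 := fun s => by
    rw [← prod_map_X]
    conv_rhs => rw [← Multiset.sort_eq s (· ≤ ·)]
    rw [Multiset.map_coe, Multiset.prod_coe]
  have hw : Finsupp.weight wt (Multiset.toFinsupp s₀) = deg s₀ := by
    refine isWeightedHomogeneous_prod_X (s₀.sort (· ≤ ·)) (d := Multiset.toFinsupp s₀) ?_
    rw [hmon]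
    simp
  have hc : ∀ s ∈ l.support, (symMap n N (orderedMonomial s)).coeff (Multiset.toFinsupp s₀)
      = if s = s₀ then 1 else 0 := by
    intro s hs
    have h := symMap_word_sub_mem n N (s.sort (· ≤ ·)) (Multiset.toFinsupp s₀)
      (hw ▸ hmax s hs)
    rw [← orderedMonomial_eq_word, MvPolynomial.coeff_sub, sub_eq_zero, hmon,
      MvPolynomial.coeff_monomial] at h
    rw [h]
    simp
  have h := congrArg (fun y => (symMap n N y).coeff (Multiset.toFinsupp s₀)) hl
  simp only [Finsupp.linearCombination_apply, Finsupp.sum, map_sum, map_smul, map_zero,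
    MvPolynomial.coeff_sum, MvPolynomial.coeff_smul, MvPolynomial.coeff_zero, smul_eq_mul] at h
  rw [Finset.sum_congr rfl fun s hs => by rw [hc s hs]] at h
  simp only [mul_ite, mul_one, mul_zero, Finset.sum_ite_eq', hs₀, if_true] at h
  exact (Finsupp.mem_support_iff.1 hs₀) h

/-- The Poincaré-Birkhoff-Witt basis of ordered monomials. -/
noncomputable def orderedBasis [LinearOrder (Gen n N)] :
    Module.Basis (Multiset (Gen n N)) ℂ (Y n N) :=
  Module.Basis.mk linearIndependent_orderedMonomial span_orderedMonomial.ge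

end Yangian

/-! ### The Poisson bracket of the associated graded algebra -/

namespace QFiltration

variable {A : Type} [Ring A] [Algebra ℂ A] (Q : QFiltration A)

theorem sym_congr {d e : ℤ} (h : d = e) {x y : A} (hx : x ∈ Q.F d) (hy : y ∈ Q.F e)
    (hxy : x = y) : Q.sym d x hx = Q.sym e y hy := by
  subst h; subst hxy; rfl

theorem sym_add {d : ℤ} {x y : A} (hx : x ∈ Q.F d) (hy : y ∈ Q.F d) :
    Q.sym d x hx + Q.sym d y hy = Q.sym d (x + y) (add_mem hx hy) :=
  (map_add ((DirectSum.lof ℂ ℤ Q.Piece d).comp (Q.cls d)) ⟨x, hx⟩ ⟨y, hy⟩).symm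

theorem sym_zero {d : ℤ} : Q.sym d 0 (zero_mem _) = 0 :=
  map_zero ((DirectSum.lof ℂ ℤ Q.Piece d).comp (Q.cls d))

theorem sym_smul {d : ℤ} (c : ℂ) {x : A} (hx : x ∈ Q.F d) :
    c • Q.sym d x hx = Q.sym d (c • x) ((Q.F d).smul_mem c hx) :=
  (map_smul ((DirectSum.lof ℂ ℤ Q.Piece d).comp (Q.cls d)) c ⟨x, hx⟩).symm

theorem sym_eq_zero {d : ℤ} {x : A} (hx : x ∈ Q.F d) (h : x ∈ Q.F (d - 1)) :
    Q.sym d x hx = 0 := by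
  rw [sym, Q.cls_eq_zero hx h, map_zero]

theorem bracket_antisymm (x y : Q.Gr) : Q.bracket x y = -Q.bracket y x := by
  rw [eq_neg_iff_add_eq_zero]
  induction x using Q.gr_induction with
  | zero => simp
  | add x x' hx hx' =>
    rw [map_add, map_add, LinearMap.add_apply, add_add_add_comm, hx, hx', add_zero]
  | sym d x hx =>
    induction y using Q.gr_induction with
    | zero => simp
    | add y y' hy hy' =>
      rw [map_add, map_add, LinearMap.add_apply, add_add_add_comm, hy, hy', add_zero]
    | sym e y hy =>
      rw [bracket_sym, bracket_sym, Q.sym_congr (show e + d - 1 = d + e - 1 by ring)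
        (Q.comm_mem hy hx) (by rw [add_comm d e]; exact Q.comm_mem hy hx) rfl, sym_add]
      exact (Q.sym_congr rfl _ (zero_mem _) (by noncomm_ring)).trans Q.sym_zero

theorem bracket_jacobi (x y z : Q.Gr) :
    Q.bracket x (Q.bracket y z) + Q.bracket y (Q.bracket z x) + Q.bracket z (Q.bracket x y) = 0 := by
  induction x using Q.gr_induction with
  | zero => simp
  | add x x' hx hx' =>
    have h := congrArg₂ (· + ·) hx hx'
    simp only [map_add, LinearMap.add_apply, add_zero] at h ⊢
    rw [← h]; abel
  | sym d x hx =>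
    induction y using Q.gr_induction with
    | zero => simp
    | add y y' hy hy' =>
      have h := congrArg₂ (· + ·) hy hy'
      simp only [map_add, LinearMap.add_apply, add_zero] at h ⊢
      rw [← h]; abel
    | sym e y hy =>
      induction z using Q.gr_induction with
      | zero => simp
      | add z z' hz hz' =>
        have h := congrArg₂ (· + ·) hz hz'
        simp only [map_add, LinearMap.add_apply, add_zero] at h ⊢
        rw [← h]; abel
      | sym f z hz =>
        simp only [bracket_sym]
        have h1 := Q.comm_mem hx (Q.comm_mem hy hz)
        have h2 := Q.comm_mem hy (Q.comm_mem hz hx)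
        have h3 := Q.comm_mem hz (Q.comm_mem hx hy)
        have e2 : e + (f + d - 1) - 1 = d + (e + f - 1) - 1 := by ring
        have e3 : f + (d + e - 1) - 1 = d + (e + f - 1) - 1 := by ring
        rw [Q.sym_congr e2 h2 (e2 ▸ h2) rfl, Q.sym_congr e3 h3 (e3 ▸ h3) rfl, sym_add, sym_add]
        exact (Q.sym_congr rfl _ (zero_mem _) (by noncomm_ring)).trans Q.sym_zero

theorem bracket_leibniz (x y z : Q.Gr) :
    Q.bracket x (y * z) = Q.bracket x y * z + y * Q.bracket x z := by
  induction x using Q.gr_induction with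
  | zero => simp
  | add x x' hx hx' =>
    simp only [map_add, LinearMap.add_apply, hx, hx', add_mul, mul_add]
    abel
  | sym d x hx =>
    induction y using Q.gr_induction with
    | zero => simp
    | add y y' hy hy' =>
      simp only [map_add, hy, hy', add_mul]
      abel
    | sym e y hy =>
      induction z using Q.gr_induction with
      | zero => simp
      | add z z' hz hz' =>
        simp only [map_add, hz, hz', mul_add]
        abel
      | sym f z hz =>
        simp only [bracket_sym, sym_mul_sym]
        have h1 := Q.mul_mem (Q.comm_mem hx hy) hz
        have h2 := Q.mul_mem hy (Q.comm_mem hx hz)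
        have e1 : d + e - 1 + f = d + (e + f) - 1 := by ring
        have e2 : e + (d + f - 1) = d + (e + f) - 1 := by ring
        rw [Q.sym_congr e1 h1 (e1 ▸ h1) rfl, Q.sym_congr e2 h2 (e2 ▸ h2) rfl, sym_add]
        exact Q.sym_congr rfl _ _ (by noncomm_ring)

theorem isPoissonBracket_bracket : IsPoissonBracket Q.bracket where
  self x := by
    have h : (2 : ℂ) • Q.bracket x x = 0 := by
      rw [two_smul, ← eq_neg_iff_add_eq_zero]
      exact Q.bracket_antisymm x x
    exact (smul_eq_zero.1 h).resolve_left two_ne_zero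
  jacobi := Q.bracket_jacobi
  leibniz := Q.bracket_leibniz

end QFiltration

/-! ### The associated graded algebra is a polynomial algebra -/

namespace Yangian

theorem grT_eq_zero (n N : ℕ) (i j : Fin n) {r : ℤ} (hr : r < -(N : ℤ)) : grT n N i j r = 0 :=
  ((filtration n N).sym_congr rfl _ (zero_mem _) (t_eq_zero n N i j hr)).trans
    (filtration n N).sym_zero

/-- The homomorphism from the polynomial algebra that sends `Δ_ij^(r)` to `gr t_ij^(r)`. -/
noncomputable def ofPoly (n N : ℕ) : OMat n N →ₐ[ℂ] GrY n N :=
  MvPolynomial.aeval fun g => grT n N g.i g.j g.r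

theorem ofPoly_X (n N : ℕ) (g : Gen n N) :
    ofPoly n N (MvPolynomial.X g) = grT n N g.i g.j g.r :=
  MvPolynomial.aeval_X _ _

theorem ofPoly_Δ (n N : ℕ) (i j : Fin n) (r : ℤ) : ofPoly n N (Δ n N i j r) = grT n N i j r := by
  unfold Δ
  split_ifs with h
  · exact ofPoly_X n N _
  · rw [map_zero, grT_eq_zero n N i j (not_le.1 h)]

theorem word_mem_filtration (n N : ℕ) {w : List (Letter n)} {d : ℤ} (h : wordDeg w ≤ d) :
    word n N w ∈ (filtration n N).F d := word_mem_fil n N h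

theorem sym_word (n N : ℕ) (w : List (Gen n N)) :
    (filtration n N).sym (wordDeg (w.map Gen.letter)) (word n N (w.map Gen.letter))
      (word_mem_filtration n N le_rfl) = ofPoly n N (w.map MvPolynomial.X).prod := by
  induction w with
  | nil =>
    rw [List.map_nil, List.map_nil, List.prod_nil, map_one]
    rfl
  | cons g w ih =>
    have e : ((g :: w).map MvPolynomial.X : List (OMat n N)).prod
        = MvPolynomial.X g * (w.map MvPolynomial.X).prod := List.prod_cons
    rw [e, map_mul, ← ih, ofPoly_X, grT, QFiltration.sym_mul_sym]
    exact (filtration n N).sym_congr (wordDeg_cons_letter g w) _ _ (word_cons_letter g w)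

/-- The bound in `lowDeg` is strict, hence `d + 1`. In particular `F (d - 1)` lands in `lowDeg d`,
where the component of weight `d` vanishes, and the symbol is well defined. -/
theorem symMap_mem_lowDeg (n N : ℕ) {d : ℤ} {x : Y n N} (hx : x ∈ fil n N d) :
    symMap n N x ∈ lowDeg n N (d + 1) := by
  refine (Submodule.span_le (p := (lowDeg n N (d + 1)).comap (symMap n N))).2 ?_ hx
  rintro _ ⟨w, hw, rfl⟩
  change symMap n N (word n N w) ∈ lowDeg n N (d + 1)
  rcases word_eq_zero_or (N := N) w with h | ⟨v, rfl⟩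
  · rw [h, map_zero]; exact zero_mem _
  · have h := add_mem (lowDeg_mono n N (show wordDeg (v.map Gen.letter) ≤ d + 1 by omega)
      (symMap_word_sub_mem n N v)) (mem_lowDeg_of_isWeightedHomogeneous
        (isWeightedHomogeneous_prod_X v) (show _ < d + 1 by omega))
    rwa [sub_add_cancel] at h

theorem weightedHomogeneousComponent_eq_zero_of_mem {n N : ℕ} {d : ℤ} {f : OMat n N}
    (hf : f ∈ lowDeg n N d) : MvPolynomial.weightedHomogeneousComponent wt d f = 0 := by
  classical
  ext m
  rw [MvPolynomial.coeff_weightedHomogeneousComponent, MvPolynomial.coeff_zero]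
  split_ifs with h
  · exact hf m h.ge
  · rfl

/-- The symbol of degree `d` of the symmetrization map. -/
noncomputable def pieceToPoly (n N : ℕ) (d : ℤ) : (filtration n N).Piece d →ₗ[ℂ] OMat n N :=
  Submodule.liftQ _ (((MvPolynomial.weightedHomogeneousComponent wt d).comp (symMap n N)).comp
    ((filtration n N).F d).subtype) fun x hx => by
      have h := symMap_mem_lowDeg n N (show x.1 ∈ fil n N (d - 1) from hx)
      rw [sub_add_cancel] at h
      exact weightedHomogeneousComponent_eq_zero_of_mem h

/-- The linear map from `gr Y^rtt(gl_n)_N` induced by the symmetrization map. -/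
noncomputable def toPoly (n N : ℕ) : GrY n N →ₗ[ℂ] OMat n N :=
  DirectSum.toModule ℂ ℤ _ (pieceToPoly n N)

theorem toPoly_sym (n N : ℕ) {d : ℤ} {x : Y n N} (hx : x ∈ (filtration n N).F d) :
    toPoly n N ((filtration n N).sym d x hx)
      = MvPolynomial.weightedHomogeneousComponent wt d (symMap n N x) :=
  DirectSum.toModule_lof _ _ _

/-- A monomial goes to the symbol of a word, and the top component of the symmetrized word is the
monomial again. -/
theorem toPoly_ofPoly (n N : ℕ) (f : OMat n N) : toPoly n N (ofPoly n N f) = f := by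
  classical
  suffices h : (toPoly n N).comp (ofPoly n N).toLinearMap = LinearMap.id from
    LinearMap.congr_fun h f
  refine MvPolynomial.linearMap_ext fun m => LinearMap.ext_ring ?_
  obtain ⟨w, hw⟩ := Quot.exists_rep (Finsupp.toMultiset m)
  have e : MvPolynomial.monomial m (1 : ℂ) = (w.map MvPolynomial.X : List (OMat n N)).prod := by
    rw [← Multiset.prod_coe, ← Multiset.map_coe, prod_map_X]
    congr 1
    rw [show (w : Multiset (Gen n N)) = Finsupp.toMultiset m from hw]
    simp
  change toPoly n N (ofPoly n N (MvPolynomial.monomial m 1)) = MvPolynomial.monomial m 1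
  rw [e, ← sym_word, toPoly_sym]
  have h := weightedHomogeneousComponent_eq_zero_of_mem (symMap_word_sub_mem n N w)
  rw [map_sub, sub_eq_zero] at h
  rw [h]
  exact (isWeightedHomogeneous_prod_X w).weightedHomogeneousComponent_same

theorem ofPoly_surjective (n N : ℕ) : Function.Surjective (ofPoly n N) := by
  intro x
  suffices h : x ∈ LinearMap.range (ofPoly n N).toLinearMap from h
  induction x using (filtration n N).gr_induction with
  | zero => exact zero_mem _
  | add x y hx hy => exact add_mem hx hy
  | sym d x hx =>
    have hx' : x ∈ fil n N d := hx
    induction hx' using Submodule.span_induction with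
    | zero => rw [QFiltration.sym_zero]; exact zero_mem _
    | add x y hx' hy' ihx ihy =>
      have hx : x ∈ (filtration n N).F d := hx'
      have hy : y ∈ (filtration n N).F d := hy'
      have h := add_mem (ihx hx) (ihy hy)
      rwa [QFiltration.sym_add] at h
    | smul c x hx' ih =>
      have hx : x ∈ (filtration n N).F d := hx'
      have h := Submodule.smul_mem _ c (ih hx)
      rwa [QFiltration.sym_smul] at h
    | mem x h =>
      obtain ⟨w, hw, rfl⟩ := h
      rcases word_eq_zero_or (N := N) w with h | ⟨v, rfl⟩
      · rw [(filtration n N).sym_congr rfl hx (zero_mem _) h, QFiltration.sym_zero]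
        exact zero_mem _
      -- A word of degree exactly `d` has a monomial as symbol; a word of smaller degree has symbol
      -- zero in degree `d`.
      · rcases hw.eq_or_lt with rfl | hlt
        · exact ⟨_, (sym_word n N v).symm⟩
        · rw [(filtration n N).sym_eq_zero hx (word_mem_fil n N (by omega))]
          exact zero_mem _

/-- The isomorphism of the polynomial algebra with `gr Y^rtt(gl_n)_N`. -/
noncomputable def polyEquiv (n N : ℕ) : OMat n N ≃ₐ[ℂ] GrY n N :=
  AlgEquiv.ofBijective (ofPoly n N)
    ⟨Function.LeftInverse.injective (toPoly_ofPoly n N), ofPoly_surjective n N⟩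

theorem polyEquiv_apply (n N : ℕ) (f : OMat n N) : polyEquiv n N f = ofPoly n N f := rfl

end Yangian

theorem QFiltration.sym_sub {A : Type} [Ring A] [Algebra ℂ A] (Q : QFiltration A) {d : ℤ}
    {x y : A} (hx : x ∈ Q.F d) (hy : y ∈ Q.F d) :
    Q.sym d x hx - Q.sym d y hy = Q.sym d (x - y) (sub_mem hx hy) :=
  (map_sub ((DirectSum.lof ℂ ℤ Q.Piece d).comp (Q.cls d)) ⟨x, hx⟩ ⟨y, hy⟩).symm

theorem QFiltration.sym_sum {A : Type} [Ring A] [Algebra ℂ A] (Q : QFiltration A) {d : ℤ}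
    {κ : Type*} (s : Finset κ) {f : κ → A} (hf : ∀ i, f i ∈ Q.F d) :
    ∑ i ∈ s, Q.sym d (f i) (hf i) = Q.sym d (∑ i ∈ s, f i) (sum_mem fun i _ => hf i) := by
  have h := map_sum ((DirectSum.lof ℂ ℤ Q.Piece d).comp (Q.cls d)) (fun i => ⟨f i, hf i⟩) s
  refine h.symm.trans ?_
  change Q.sym d (↑(∑ i ∈ s, (⟨f i, hf i⟩ : Q.F d))) _ = _
  exact Q.sym_congr rfl _ _ (by simp)

/-! ### Transport of Poisson brackets and inverse limits -/

theorem IsPoissonBracket.of_injective {A B : Type} [CommRing A] [Algebra ℂ A] [CommRing B]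
    [Algebra ℂ B] {br : A →ₗ[ℂ] A →ₗ[ℂ] A} {br' : B →ₗ[ℂ] B →ₗ[ℂ] B} (h : IsPoissonBracket br')
    (φ : A →ₐ[ℂ] B) (hφ : Function.Injective φ) (hb : ∀ x y, φ (br x y) = br' (φ x) (φ y)) :
    IsPoissonBracket br where
  self x := hφ (by rw [hb, h.self, map_zero])
  jacobi x y z := hφ (by simp only [map_add, hb, h.jacobi, map_zero])
  leibniz x y z := hφ (by simp only [map_add, map_mul, hb, h.leibniz])

section InvLimit

variable {A B : ℕ → Type} [∀ N, CommRing (A N)] [∀ N, Algebra ℂ (A N)] [∀ N, CommRing (B N)]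
  [∀ N, Algebra ℂ (B N)]

theorem isPoissonBracket_invLimitBracket (π : ∀ N, A (N + 1) →ₐ[ℂ] A N)
    (br : ∀ N, A N →ₗ[ℂ] A N →ₗ[ℂ] A N)
    (h : ∀ N x y, π N (br (N + 1) x y) = br N (π N x) (π N y))
    (hP : ∀ N, IsPoissonBracket (br N)) : IsPoissonBracket (invLimitBracket π br h) where
  self _ := Subtype.ext (funext fun N => (hP N).self _)
  jacobi _ _ _ := Subtype.ext (funext fun N => (hP N).jacobi _ _ _)
  leibniz _ _ _ := Subtype.ext (funext fun N => (hP N).leibniz _ _ _)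

/-- The isomorphism of inverse limits induced by compatible isomorphisms. -/
def invLimitEquiv (π : ∀ N, A (N + 1) →ₐ[ℂ] A N) (ρ : ∀ N, B (N + 1) →ₐ[ℂ] B N)
    (φ : ∀ N, A N ≃ₐ[ℂ] B N) (h : ∀ N x, ρ N (φ (N + 1) x) = φ N (π N x)) :
    invLimit π ≃ₐ[ℂ] invLimit ρ where
  toFun x := ⟨fun N => φ N (x.1 N), fun N => by rw [h, x.2 N]⟩
  invFun y := ⟨fun N => (φ N).symm (y.1 N), fun N => by
    rw [AlgEquiv.eq_symm_apply, ← h, AlgEquiv.apply_symm_apply, y.2 N]⟩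
  left_inv x := Subtype.ext (funext fun N => (φ N).symm_apply_apply _)
  right_inv y := Subtype.ext (funext fun N => (φ N).apply_symm_apply _)
  map_mul' _ _ := Subtype.ext (funext fun N => map_mul (φ N) _ _)
  map_add' _ _ := Subtype.ext (funext fun N => map_add (φ N) _ _)
  commutes' c := Subtype.ext (funext fun N => (φ N).commutes c)

end InvLimit

/-! ### Comparison of the Poisson brackets and passage to the limit. -/

namespace Yangian

theorem isPoissonBracket_grYBracket (n N : ℕ) : IsPoissonBracket (grYBracket n N) :=
  (filtration n N).isPoissonBracket_bracket

/-- All terms of the commutator formula have degree exactly `p + q - 1`, so it survives unchanged in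
the graded algebra, where its factors commute. -/
theorem grYBracket_grT (n N : ℕ) (i j k l : Fin n) (p q : ℤ) :
    grYBracket n N (grT n N i j p) (grT n N k l q) = ofPoly n N (bracketΔ n N i j p k l q) := by
  have hm : ∀ (i j k l : Fin n) (a b : ℤ), a + b = p + q - 1 →
      t n N i j a * t n N k l b ∈ (filtration n N).F (p + q - 1) := fun i j k l a b h => by
    rw [← h]
    exact (filtration n N).mul_mem (t_mem_filtration n N i j a) (t_mem_filtration n N k l b)
  have hs : ∀ (i j k l : Fin n) (a b : ℤ) (h : a + b = p + q - 1),
      grT n N i j a * grT n N k l b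
        = (filtration n N).sym (p + q - 1) (t n N i j a * t n N k l b) (hm i j k l a b h) :=
    fun i j k l a b h => by
      rw [grT, grT, QFiltration.sym_mul_sym]
      exact (filtration n N).sym_congr h _ _ rfl
  rw [grYBracket, grT, grT, QFiltration.bracket_sym, bracketΔ, map_sum]
  simp only [map_sub, map_mul, ofPoly_Δ]
  rw [Finset.sum_congr rfl fun a _ => by
    rw [mul_comm (grT n N i l a), hs k j i l (p + q - 1 - a) a (by ring),
      hs k j i l a (p + q - 1 - a) (by ring), QFiltration.sym_sub], QFiltration.sym_sum _ _
      fun a => sub_mem (hm k j i l (p + q - 1 - a) a (by ring))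
        (hm k j i l a (p + q - 1 - a) (by ring))]
  exact (filtration n N).sym_congr rfl _ _ (by rw [t_mul_t, add_sub_cancel_left])

/-- Both sides obey the Leibniz rule in each argument, which reduces the comparison to pairs of
generators. -/
theorem ofPoly_bracket (n N : ℕ) (f g : OMat n N) :
    ofPoly n N (OMatBracket n N f g) = grYBracket n N (ofPoly n N f) (ofPoly n N g) := by
  have hL : ∀ x y z, grYBracket n N x (y * z) = grYBracket n N x y * z + y * grYBracket n N x z :=
    (isPoissonBracket_grYBracket n N).leibniz
  have hA : ∀ x y, grYBracket n N x y = -grYBracket n N y x :=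
    (filtration n N).bracket_antisymm
  have h1 : ∀ x, grYBracket n N x 1 = 0 := fun x => by simpa using hL x 1 1
  have hC : ∀ x (c : ℂ), grYBracket n N x (ofPoly n N (MvPolynomial.C c)) = 0 := fun x c => by
    rw [← MvPolynomial.algebraMap_eq, AlgHom.commutes, Algebra.algebraMap_eq_smul_one, map_smul,
      h1, smul_zero]
  induction f using MvPolynomial.induction_on with
  | C c => rw [OMatBracket_C_left, hA, hC, neg_zero, map_zero]
  | add f f' hf hf' => simp only [map_add, LinearMap.add_apply, hf, hf']
  | mul_X f a hf =>
    have h : ofPoly n N (OMatBracket n N (MvPolynomial.X a) g)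
        = grYBracket n N (ofPoly n N (MvPolynomial.X a)) (ofPoly n N g) := by
      clear hf
      induction g using MvPolynomial.induction_on with
      | C c => rw [OMatBracket_C_right, hC, map_zero]
      | add g g' hg hg' => simp only [map_add, hg, hg']
      | mul_X g b hg =>
        rw [OMatBracket_leibniz_right, map_add, map_mul, map_mul, hg, OMatBracket_X_X, map_mul,
          hL, ofPoly_X, ofPoly_X, grYBracket_grT]
        ring
    rw [OMatBracket_leibniz_left, map_add, map_mul, map_mul, hf, h, map_mul,
      hA (ofPoly n N f * _), hL, hA (ofPoly n N g), hA (ofPoly n N g)]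
    ring

theorem grTrans_ofPoly (n N : ℕ) (f : OMat n (N + 1)) :
    grTrans n N (ofPoly n (N + 1) f) = ofPoly n N (OMatTrans n N f) := by
  have h : (grTrans n N).comp (ofPoly n (N + 1)) = (ofPoly n N).comp (OMatTrans n N) := by
    refine MvPolynomial.algHom_ext fun a => ?_
    rw [AlgHom.comp_apply, AlgHom.comp_apply, ← Δ_gen, OMatTrans_Δ, ofPoly_Δ, ofPoly_Δ,
      grTrans_grT]
  exact DFunLike.congr_fun h f

theorem OMatTrans_polyEquiv_symm (n N : ℕ) (x : GrY n (N + 1)) :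
    OMatTrans n N ((polyEquiv n (N + 1)).symm x) = (polyEquiv n N).symm (grTrans n N x) := by
  obtain ⟨f, rfl⟩ := (polyEquiv n (N + 1)).surjective x
  rw [AlgEquiv.symm_apply_apply, AlgEquiv.eq_symm_apply, polyEquiv_apply, polyEquiv_apply,
    grTrans_ofPoly]

theorem polyEquiv_symm_bracket (n N : ℕ) (x y : GrY n N) :
    (polyEquiv n N).symm (grYBracket n N x y)
      = OMatBracket n N ((polyEquiv n N).symm x) ((polyEquiv n N).symm y) := by
  rw [AlgEquiv.symm_apply_eq, polyEquiv_apply, ofPoly_bracket, ← polyEquiv_apply,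
    ← polyEquiv_apply, AlgEquiv.apply_symm_apply, AlgEquiv.apply_symm_apply]

theorem polyEquiv_symm_grT (n N : ℕ) (i j : Fin n) (r : ℤ) :
    (polyEquiv n N).symm (grT n N i j r) = Δ n N i j r := by
  rw [AlgEquiv.symm_apply_eq, polyEquiv_apply, ofPoly_Δ]

/-- The Jacobi identity and antisymmetry are pulled back from the commutator bracket along the
injective map `ofPoly`. -/
theorem isPoissonBracket_OMatBracket (n N : ℕ) : IsPoissonBracket (OMatBracket n N) :=
  (isPoissonBracket_grYBracket n N).of_injective (ofPoly n N)
    (Function.LeftInverse.injective (toPoly_ofPoly n N)) (ofPoly_bracket n N)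

/-- The isomorphism of `gr Y^rtt(gl_n)` with the functions on `Mat_n((z⁻¹))`. -/
noncomputable def limEquiv (n : ℕ) : GrYLim n ≃ₐ[ℂ] OMatLaurent n :=
  invLimitEquiv (A := GrY n) (B := OMat n) (grTrans n) (OMatTrans n)
    (fun N => (polyEquiv n N).symm) (OMatTrans_polyEquiv_symm n)

end Yangian

theorem mainTheorem6 (n : ℕ) :
    -- PBW: for every total order on the generators, the ordered monomials form a basis
    (∀ (N : ℕ) (_ : LinearOrder (Yangian.Gen n N)),
      ∃ b : Module.Basis (Multiset (Yangian.Gen n N)) ℂ (Yangian.Y n N),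
        ∀ s, b s = Yangian.orderedMonomial s) ∧
    -- the associated graded algebra is the polynomial algebra in the `gr t_ij^(r)`, `r ≥ -N`
    (∀ N : ℕ, ∃ e : MvPolynomial (Yangian.Gen n N) ℂ ≃ₐ[ℂ] Yangian.GrY n N,
      ∀ g, e (MvPolynomial.X g) = Yangian.grT n N g.i g.j g.r) ∧
    -- all four brackets are Poisson brackets
    (∀ N : ℕ, IsPoissonBracket (Yangian.grYBracket n N)) ∧
    (∀ N : ℕ, IsPoissonBracket (Yangian.OMatBracket n N)) ∧
    IsPoissonBracket (Yangian.grYLimBracket n) ∧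
    IsPoissonBracket (Yangian.OMatLaurentBracket n) ∧
    -- the isomorphism of Poisson algebras, which is the limit of isomorphisms `φ N`
    ∃ (Φ : Yangian.GrYLim n ≃ₐ[ℂ] Yangian.OMatLaurent n)
      (φ : ∀ N : ℕ, Yangian.GrY n N ≃ₐ[ℂ] Yangian.OMat n N),
      (∀ i j r, Φ (Yangian.grTLim n i j r) = Yangian.ΔLaurent n i j r) ∧
      (∀ x y, Φ (Yangian.grYLimBracket n x y) = Yangian.OMatLaurentBracket n (Φ x) (Φ y)) ∧
      (∀ N i j r, φ N (Yangian.grT n N i j r) = Yangian.Δ n N i j r) ∧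
      (∀ N x y, φ N (Yangian.grYBracket n N x y) = Yangian.OMatBracket n N (φ N x) (φ N y)) ∧
      (∀ N x, (Φ x).1 N = φ N (x.1 N)) := by
  refine ⟨fun N _ => ⟨Yangian.orderedBasis, fun s => ?_⟩,
    fun N => ⟨Yangian.polyEquiv n N, Yangian.ofPoly_X n N⟩,
    Yangian.isPoissonBracket_grYBracket n, Yangian.isPoissonBracket_OMatBracket n,
    isPoissonBracket_invLimitBracket _ _ _ (Yangian.isPoissonBracket_grYBracket n),
    isPoissonBracket_invLimitBracket _ _ _ (Yangian.isPoissonBracket_OMatBracket n),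
    Yangian.limEquiv n, fun N => (Yangian.polyEquiv n N).symm, fun i j r => ?_, fun x y => ?_,
    Yangian.polyEquiv_symm_grT n, Yangian.polyEquiv_symm_bracket n, fun N x => rfl⟩
  · rw [Yangian.orderedBasis, Module.Basis.mk_apply]
  · exact Subtype.ext (funext fun N => Yangian.polyEquiv_symm_grT n N i j r)
  · exact Subtype.ext (funext fun N => Yangian.polyEquiv_symm_bracket n N _ _)
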